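/- **Theorem 1.** Let $n\ge 0$ and let $\mathbf E$ be the set of all linear subspaces of $\mathbb R^n$. For $E\in\mathbf E$ let $P_E$ be the orthogonal projection of $\mathbb R^n$ onto $E$, and equip $\mathbf E$ with the coarsest topology making $E\mapsto P_E\in M_{n\times n}(\mathbb R)$ continuous and with the corresponding Borel $\sigma$-algebra. For a topological space $\mathsf X$, $P(\mathsf X)$ denotes the set of Borel probability measures on $\mathsf X$. For $\mu\in P(\mathbb R^n)$ and $E\in\mathbf E$, let $\mu_E\in P(E)$ be the marginal of $\mu$ on $E$, i.e. its pushforward under the orthogonal projection $\mathbb R^n\to E$. For mutually orthogonal subspaces with sum $\mathbb R^n$, a product of measures on these subspaces is regarded as a measure on $\mathbb R^n$. Fix $\xi\in P(\mathbf E)$ and put $$\chi_\xi(x)=\int_{\mathbf E}\min\{\|P_Ex\|,\|P_{E^\perp}x\|\}\,d\xi(E),\qquad x\in\mathbb R^n .$$ There is a unique (finite, possibly empty) family $(E_\alpha)_\alpha$ of distinct, nonzero, mutually orthogonal subspaces such that $\chi_\xi^{-1}(0)=\{0\}\cup\bigcup_\alpha E_\alpha$. These $E_\alpha$ are called the independent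 subspaces with respect to $\xi$, and $E_{dep}:=\left(\bigoplus_\alpha E_\alpha\right)^\perp$ is called the dependent subspace. For every $\mu\in P(\mathbb R^n)$ the following are equivalent: 1. $\mu$ splits with respect to $\xi$, that is, $\mu=\mu_E\otimes\mu_{E^\perp}$ for $\xi$-a.e. $E\in\mathbf E$. 2. $\mu=\left(\bigotimes_\alpha\mu_{E_\alpha}\right)\otimes\mu_{E_{dep}}$, where $\mu_{E_{dep}}$ is a (possibly degenerate, not necessarily centered) Gaussian measure whose covariance splits with respect to $\xi$, that is, $$\int_{\mathbf E}\left\|P_E\,\operatorname{Cov}(P_{E_{dep}}\#\mu)\,P_{E^\perp}\right\|\,d\xi(E)=0,$$ where $P_{E_{dep}}\#\mu$ is the pushforward of $\mu$ under $P_{E_{dep}}$ (the choice of matrix norm is immaterial). 3. $\int_{E_{dep}}\log(1+\|x\|)\,d\mu_{E_{dep}}(x)<\infty$, and $\mu$ is the mixture $$\mu=\int_{\mathbf E}(\mu_E\otimes\mu_{E^\perp})\,d\xi(E).$$ -/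

import Mathlib

open MeasureTheory ProbabilityTheory

namespace SplittingMeasures

/-- `ℝⁿ` with its Euclidean structure. -/
abbrev Euc (n : ℕ) : Type := EuclideanSpace ℝ (Fin n)

/-- The set of all linear subspaces of `ℝⁿ`. -/
abbrev Subsp (n : ℕ) : Type := Submodule ℝ (Euc n)

/-- The coarsest topology on the set of subspaces that makes `E ↦ P_E` continuous. The projections
are taken as continuous endomorphisms of `ℝⁿ`; this finite-dimensional space has the same topology
as the space of matrices. -/
noncomputable instance instTopologicalSpaceSubsp (n : ℕ) : TopologicalSpace (Subsp n) :=
  TopologicalSpace.induced (fun E : Subsp n => E.starProjection) inferInstance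

/-- The Borel σ-algebra on the set of subspaces. -/
noncomputable instance instMeasurableSpaceSubsp (n : ℕ) : MeasurableSpace (Subsp n) := borel (Subsp n)

instance instBorelSpaceSubsp (n : ℕ) : BorelSpace (Subsp n) := ⟨rfl⟩

variable {n : ℕ}

/-- The marginal `μ_E`, a measure on `E`: the pushforward of `μ` by the orthogonal projection
`ℝⁿ → E`. -/
noncomputable def marginal (μ : Measure (Euc n)) (E : Subsp n) : Measure E :=
  μ.map E.orthogonalProjectionOnto

/-- The product `μ_E ⊗ μ_{E^⊥}`, a measure on `ℝⁿ = E ⊕ E^⊥`. -/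
noncomputable def marginalProd (μ : Measure (Euc n)) (E : Subsp n) : Measure (Euc n) :=
  ((marginal μ E).prod (marginal μ Eᗮ)).map fun p : E × (Eᗮ : Subsp n) => (p.1 : Euc n) + p.2

/-- `μ` splits along `(E, E^⊥)`. -/
def SplitsAlong (μ : Measure (Euc n)) (E : Subsp n) : Prop :=
  μ = marginalProd μ E

/-- `μ` splits with respect to `ξ`. -/
def SplitsWrt (μ : Measure (Euc n)) (ξ : Measure (Subsp n)) : Prop :=
  ∀ᵐ E ∂ξ, SplitsAlong μ E

/-- The function `χ_ξ(x) = ∫ min(‖P_E x‖, ‖P_{E^⊥} x‖) dξ(E)`. -/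
noncomputable def chi (ξ : Measure (Subsp n)) (x : Euc n) : ℝ :=
  ∫ E, min ‖E.starProjection x‖ ‖(Eᗮ : Subsp n).starProjection x‖ ∂ξ

/-- The independent subspaces with respect to `ξ`: the nonzero subspaces that are maximal among
the subspaces contained in the zero set of `χ_ξ`. By `isIndependentFamily_iff` below this is the
unique family of nonzero, mutually orthogonal subspaces whose union (with `0`) is the zero set. -/
def independentSubspaces (ξ : Measure (Subsp n)) : Set (Subsp n) :=
  {E | E ≠ ⊥ ∧ Maximal (fun F : Subsp n => ∀ x ∈ F, chi ξ x = 0) E}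

/-- `S` is a family of distinct, nonzero, mutually orthogonal subspaces whose union, together with
`0`, is the zero set of `χ_ξ`. -/
def IsIndependentFamily (ξ : Measure (Subsp n)) (S : Set (Subsp n)) : Prop :=
  (∀ E ∈ S, E ≠ ⊥) ∧ (S.Pairwise fun E F => E ⟂ F) ∧
    {x | chi ξ x = 0} = {0} ∪ ⋃ E ∈ S, (E : Set (Euc n))

/-- The dependent subspace with respect to `ξ`: the orthogonal complement of the sum of the
independent subspaces. -/
noncomputable def depSubspace (ξ : Measure (Subsp n)) : Subsp n :=
  (sSup (independentSubspaces ξ))ᗮ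

/-! The independent decomposition is well defined. -/

theorem continuous_starProjection_subsp :
    Continuous fun E : Subsp n => E.starProjection :=
  continuous_induced_dom

theorem continuous_starProjection_orthogonal_subsp :
    Continuous fun E : Subsp n => (Eᗮ : Subsp n).starProjection := by
  simp_rw [Submodule.starProjection_orthogonal]
  exact continuous_const.sub continuous_starProjection_subsp

theorem min_norm_eq_zero_iff (E : Subsp n) (x : Euc n) :
    min ‖E.starProjection x‖ ‖(Eᗮ : Subsp n).starProjection x‖ = 0 ↔ x ∈ E ∨ x ∈ Eᗮ := by
  have h1 : ‖E.starProjection x‖ = 0 ↔ x ∈ Eᗮ := by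
    rw [norm_eq_zero, Submodule.starProjection_apply_eq_zero_iff]
  have h2 : ‖(Eᗮ : Subsp n).starProjection x‖ = 0 ↔ x ∈ E := by
    rw [norm_eq_zero, Submodule.starProjection_apply_eq_zero_iff, Submodule.orthogonal_orthogonal]
  rw [← h1, ← h2]
  have a := norm_nonneg (E.starProjection x)
  have b := norm_nonneg ((Eᗮ : Subsp n).starProjection x)
  constructor
  · intro h
    rcases min_choice ‖E.starProjection x‖ ‖(Eᗮ : Subsp n).starProjection x‖ with h' | h'
    · right; rw [← h', h]
    · left; rw [← h', h]
  · rintro (h | h)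
    · rw [h]; exact min_eq_right a
    · rw [h]; exact min_eq_left b

theorem integrable_min_norm (ξ : Measure (Subsp n)) [IsProbabilityMeasure ξ] (x : Euc n) :
    Integrable (fun E : Subsp n =>
      min ‖E.starProjection x‖ ‖(Eᗮ : Subsp n).starProjection x‖) ξ := by
  have hc : Continuous (fun E : Subsp n =>
      min ‖E.starProjection x‖ ‖(Eᗮ : Subsp n).starProjection x‖) :=
    (continuous_starProjection_subsp.clm_apply continuous_const).norm.min
      (continuous_starProjection_orthogonal_subsp.clm_apply continuous_const).norm
  refine Integrable.of_bound hc.measurable.aestronglyMeasurable ‖x‖ (Filter.Eventually.of_forall ?_)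
  intro E
  rw [Real.norm_of_nonneg (le_min (norm_nonneg _) (norm_nonneg _))]
  exact (min_le_left _ _).trans (E.norm_starProjection_apply_le x)

theorem chi_eq_zero_iff (ξ : Measure (Subsp n)) [IsProbabilityMeasure ξ] (x : Euc n) :
    chi ξ x = 0 ↔ ∀ᵐ E : Subsp n ∂ξ, x ∈ E ∨ x ∈ (Eᗮ : Subsp n) := by
  unfold chi
  rw [integral_eq_zero_iff_of_nonneg (fun E => le_min (norm_nonneg _) (norm_nonneg _))
    (integrable_min_norm ξ x)]
  simp only [Filter.EventuallyEq, Pi.zero_apply, min_norm_eq_zero_iff]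

/-- If `u ≠ 0` and `u`, `v`, `u + v` all lie in `E ∪ E^⊥`, then `v` lies on the same side as `u`. -/
theorem same_side {E : Subsp n} {u v : Euc n} (hu0 : u ≠ 0) (hv : v ∈ E ∨ v ∈ Eᗮ)
    (huv : u + v ∈ E ∨ u + v ∈ Eᗮ) (hu : u ∈ E) : v ∈ E := by
  rcases huv with h | h
  · simpa using E.sub_mem h hu
  · rcases hv with hv | hv
    · exact hv
    · have hu' : u ∈ Eᗮ := by simpa using Eᗮ.sub_mem h hv
      exact absurd (inner_self_eq_zero.1 ((Submodule.mem_orthogonal E u).1 hu' u hu)) hu0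

theorem same_side_orthogonal {E : Subsp n} {u v : Euc n} (hu0 : u ≠ 0) (hv : v ∈ E ∨ v ∈ Eᗮ)
    (huv : u + v ∈ E ∨ u + v ∈ Eᗮ) (hu : u ∈ Eᗮ) : v ∈ Eᗮ := by
  refine same_side hu0 ?_ ?_ hu
  · rw [Submodule.orthogonal_orthogonal]; exact hv.symm
  · rw [Submodule.orthogonal_orthogonal]; exact huv.symm

theorem independentSubspaces_pairwise (ξ : Measure (Subsp n)) [IsProbabilityMeasure ξ] :
    (independentSubspaces ξ).Pairwise fun E F => E ⟂ F := by
  rintro U ⟨-, hU⟩ V ⟨-, hV⟩ hne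
  by_contra hnot
  rw [Submodule.isOrtho_iff_inner_eq] at hnot
  push Not at hnot
  obtain ⟨u, hu, v, hv, huv⟩ := hnot
  have hu0 : u ≠ 0 := by rintro rfl; simp at huv
  have hv0 : v ≠ 0 := by rintro rfl; simp at huv
  have hsup : ∀ x ∈ U ⊔ V, chi ξ x = 0 := by
    intro x hx
    obtain ⟨u', hu', v', hv', rfl⟩ := Submodule.mem_sup.1 hx
    rw [chi_eq_zero_iff]
    filter_upwards [(chi_eq_zero_iff ξ _).1 (hU.prop u hu), (chi_eq_zero_iff ξ _).1 (hV.prop v hv),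
      (chi_eq_zero_iff ξ _).1 (hU.prop u' hu'), (chi_eq_zero_iff ξ _).1 (hV.prop v' hv'),
      (chi_eq_zero_iff ξ _).1 (hU.prop _ (U.add_mem hu hu')),
      (chi_eq_zero_iff ξ _).1 (hV.prop _ (V.add_mem hv hv'))] with E h1 h2 h3 h4 h5 h6
    rcases h1 with h1 | h1 <;> rcases h2 with h2 | h2
    · exact Or.inl (E.add_mem (same_side hu0 h3 h5 h1) (same_side hv0 h4 h6 h2))
    · exact absurd ((Submodule.mem_orthogonal E v).1 h2 u h1) huv
    · exact absurd ((Submodule.mem_orthogonal' E u).1 h1 v h2) huv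
    · exact Or.inr (Eᗮ.add_mem (same_side_orthogonal hu0 h3 h5 h1)
        (same_side_orthogonal hv0 h4 h6 h2))
  exact hne ((hU.eq_of_le hsup le_sup_left).trans (hV.eq_of_le hsup le_sup_right).symm)

theorem chi_zero (ξ : Measure (Subsp n)) : chi ξ 0 = 0 := by
  simp [chi]

theorem chi_smul_eq_zero (ξ : Measure (Subsp n)) [IsProbabilityMeasure ξ] {x : Euc n}
    (hx : chi ξ x = 0) (c : ℝ) : chi ξ (c • x) = 0 := by
  rw [chi_eq_zero_iff] at hx ⊢
  filter_upwards [hx] with E hE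
  exact hE.imp (E.smul_mem c) (Eᗮ.smul_mem c)

theorem isIndependentFamily_independentSubspaces (ξ : Measure (Subsp n)) [IsProbabilityMeasure ξ] :
    IsIndependentFamily ξ (independentSubspaces ξ) := by
  refine ⟨fun E hE => hE.1, independentSubspaces_pairwise ξ, ?_⟩
  ext x
  simp only [Set.mem_ofPred_eq, Set.mem_union, Set.mem_singleton_iff, Set.mem_iUnion,
    SetLike.mem_coe, exists_prop]
  constructor
  · intro hx
    by_cases hx0 : x = 0
    · exact Or.inl hx0
    · right
      obtain ⟨E, hle, hE⟩ := exists_maximal_ge_of_wellFoundedGT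
        (fun F : Subsp n => ∀ x ∈ F, chi ξ x = 0) (Submodule.span ℝ {x}) (by
          intro y hy
          obtain ⟨c, rfl⟩ := Submodule.mem_span_singleton.1 hy
          exact chi_smul_eq_zero ξ hx c)
      have hxE : x ∈ E := hle (Submodule.mem_span_singleton_self x)
      refine ⟨E, ⟨?_, hE⟩, hxE⟩
      rintro rfl
      exact hx0 ((Submodule.mem_bot ℝ).1 hxE)
  · rintro (rfl | ⟨E, hE, hx⟩)
    · exact chi_zero ξ
    · exact hE.2.prop x hx

/-- Existence and uniqueness of the decomposition of the zero set of `χ_ξ`. -/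
theorem isIndependentFamily_iff (ξ : Measure (Subsp n)) [IsProbabilityMeasure ξ]
    (S : Set (Subsp n)) : IsIndependentFamily ξ S ↔ S = independentSubspaces ξ := by
  refine ⟨?_, fun h => h ▸ isIndependentFamily_independentSubspaces ξ⟩
  rintro ⟨hne, hpw, hZ⟩
  have hmem : ∀ x : Euc n, chi ξ x = 0 → x ≠ 0 → ∃ E ∈ S, x ∈ E := by
    intro x hx hx0
    have h : x ∈ {x | chi ξ x = 0} := hx
    rw [hZ] at h
    simpa [hx0] using h
  have hsub : ∀ E ∈ S, ∀ x ∈ E, chi ξ x = 0 := by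
    intro E hE x hx
    have h : x ∈ {x | chi ξ x = 0} := by
      rw [hZ]
      exact Or.inr (Set.mem_biUnion hE hx)
    exact h
  have key : ∀ E ∈ S, ∀ F : Subsp n, (∀ x ∈ F, chi ξ x = 0) → ∀ e ∈ E, e ≠ 0 → e ∈ F → F ≤ E := by
    intro E hE F hF e heE he0 heF f hf
    by_cases hf0 : f = 0
    · rw [hf0]; exact E.zero_mem
    by_cases hs : e + f = 0
    · rw [← neg_eq_of_add_eq_zero_right hs]; exact E.neg_mem heE
    obtain ⟨E1, hE1, hf1⟩ := hmem f (hF f hf) hf0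
    obtain ⟨E2, hE2, hs2⟩ := hmem (e + f) (hF _ (F.add_mem heF hf)) hs
    by_cases h1 : E1 = E
    · rwa [h1] at hf1
    by_cases h2 : E2 = E
    · rw [h2] at hs2
      simpa using E.sub_mem hs2 heE
    have i1 : inner ℝ f e = 0 := Submodule.isOrtho_iff_inner_eq.1 (hpw hE1 hE h1) f hf1 e heE
    have i2 : inner ℝ (e + f) e = 0 :=
      Submodule.isOrtho_iff_inner_eq.1 (hpw hE2 hE h2) _ hs2 e heE
    rw [inner_add_left, i1, add_zero] at i2
    exact absurd (inner_self_eq_zero.1 i2) he0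
  ext E
  constructor
  · intro hE
    obtain ⟨e, he, he0⟩ := Submodule.exists_mem_ne_zero_of_ne_bot (hne E hE)
    exact ⟨hne E hE, hsub E hE, fun F hF hle => key E hE F hF e he he0 (hle he)⟩
  · rintro ⟨hb, hmax⟩
    obtain ⟨e, he, he0⟩ := Submodule.exists_mem_ne_zero_of_ne_bot hb
    obtain ⟨E', hE', heE'⟩ := hmem e (hmax.prop e he) he0
    have := hmax.eq_of_le (hsub E' hE') (key E' hE' E hmax.prop e heE' he0 he)
    rwa [this]

theorem finite_independentSubspaces (ξ : Measure (Subsp n)) [IsProbabilityMeasure ξ] :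
    Finite (independentSubspaces ξ) := by
  have hort : OrthogonalFamily ℝ (fun E : independentSubspaces ξ => (E : Subsp n))
      fun E => (E : Subsp n).subtypeₗᵢ := by
    intro E F hEF v w
    exact Submodule.isOrtho_iff_inner_eq.1
      (independentSubspaces_pairwise ξ E.2 F.2 (fun h => hEF (Subtype.ext h))) v v.2 w w.2
  exact WellFoundedGT.finite_of_iSupIndep hort.independent fun E => E.2.1

noncomputable instance instFintypeIndependentSubspaces (ξ : Measure (Subsp n))
    [IsProbabilityMeasure ξ] : Fintype (independentSubspaces ξ) :=
  haveI := finite_independentSubspaces ξ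
  Fintype.ofFinite _

/-- The product `(⊗_α μ_{E_α}) ⊗ μ_{E_dep}`, a measure on `ℝⁿ = (⊕_α E_α) ⊕ E_dep`. -/
noncomputable def independentProd (ξ : Measure (Subsp n)) [IsProbabilityMeasure ξ]
    (μ : Measure (Euc n)) : Measure (Euc n) :=
  ((Measure.pi fun α : independentSubspaces ξ => marginal μ α.1).prod
      (marginal μ (depSubspace ξ))).map
    fun p : ((α : independentSubspaces ξ) → α.1) × depSubspace ξ =>
      (∑ α, (p.1 α : Euc n)) + p.2

/-- The (centered) covariance of a measure on `ℝⁿ`, as an operator `C` on `ℝⁿ` with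
`⟪C x, y⟫ = Cov(⟪x, ·⟫, ⟪y, ·⟫)`. -/
noncomputable def covOp (ν : Measure (Euc n)) : Euc n →L[ℝ] Euc n :=
  InnerProductSpace.continuousLinearMapOfBilin (𝕜 := ℝ) (covarianceBilin ν)

/-- The covariance of `μ_V` splits with respect to `ξ`:
`∫ ‖P_E Cov(P_V # μ) P_{E^⊥}‖ dξ(E) = 0`. -/
def CovSplits (μ : Measure (Euc n)) (V : Subsp n) (ξ : Measure (Subsp n)) : Prop :=
  ∫ E, ‖E.starProjection ∘L covOp (μ.map V.starProjection) ∘L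
    (Eᗮ : Subsp n).starProjection‖ ∂ξ = 0

/-- `E ↦ μ_E ⊗ μ_{E^⊥}` is measurable, so that the mixture `∫ (μ_E ⊗ μ_{E^⊥}) dξ(E)` is the
measure `ξ.bind (marginalProd μ)`. -/
theorem measurable_marginalProd (μ : Measure (Euc n)) [IsProbabilityMeasure μ] :
    Measurable (marginalProd μ) := by
  have h : Measurable fun q : Subsp n × (Euc n × Euc n) =>
      q.1.starProjection q.2.1 + (q.1ᗮ : Subsp n).starProjection q.2.2 := by
    have a : Measurable fun p : (Euc n →L[ℝ] Euc n) × Euc n => p.1 p.2 :=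
      ContinuousLinearMap.measurable_apply₂
    exact (a.comp ((continuous_starProjection_subsp.measurable.comp measurable_fst).prodMk
      (measurable_fst.comp measurable_snd))).add
      (a.comp ((continuous_starProjection_orthogonal_subsp.measurable.comp measurable_fst).prodMk
      (measurable_snd.comp measurable_snd)))
  have heq : ∀ E : Subsp n, marginalProd μ E = (μ.prod μ).map fun q : Euc n × Euc n =>
      E.starProjection q.1 + (Eᗮ : Subsp n).starProjection q.2 := by
    intro E
    unfold marginalProd marginal
    rw [Measure.map_prod_map _ _ (by fun_prop) (by fun_prop), Measure.map_map (by fun_prop)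
      (by fun_prop)]
    rfl
  refine Measure.measurable_of_measurable_coe _ fun s hs => ?_
  have : (fun E => marginalProd μ E s) = fun E : Subsp n => (μ.prod μ) (Prod.mk E ⁻¹'
      ((fun q : Subsp n × (Euc n × Euc n) =>
      q.1.starProjection q.2.1 + (q.1ᗮ : Subsp n).starProjection q.2.2) ⁻¹' s)) := by
    funext E
    have hE : Measurable fun q : Euc n × Euc n =>
        E.starProjection q.1 + (Eᗮ : Subsp n).starProjection q.2 := by fun_prop
    rw [heq, Measure.map_apply hE hs]
    rfl
  rw [this]
  exact measurable_measure_prodMk_left (h hs)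

/-- `μ` is the mixture `∫ (μ_E ⊗ μ_{E^⊥}) dξ(E)`. -/
def IsMixture (μ : Measure (Euc n)) (ξ : Measure (Subsp n)) : Prop :=
  μ = ξ.bind (marginalProd μ)

end SplittingMeasures

open MeasureTheory ProbabilityTheory

namespace SplittingMeasures

open scoped RealInnerProductSpace ENNReal

variable {n : ℕ}

/-! ### Orthogonal projections and characteristic functions -/

/-! Write φ for the characteristic function of μ. Splitting along E means φ(x) = φ(P_E x) φ(P_{E^⊥}
x), and being the mixture means that this holds after averaging the right side over ξ. Everything
rests on the operator Tu(x) = ∫ (u(P_E x) + u(P_{E^⊥} x)) dξ(E). Suppose u ≤ Tu, TN ≤ N, TL ≤ ρL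
with ρ < 1, and u ≤ N + C·L. Iteration then gives u ≤ N + ρ^k·C·L for all k, so u ≤ N
(`le_of_subharmonic`). By Pythagoras ‖x‖² is a fixed point of T, while ‖x‖⁴ is strictly contracted
on the dependent subspace, because there χ_ξ vanishes only at 0 (`exists_fourth_power_contraction`).

Second moments. If 1 - |φ| dominated every multiple of ‖y‖² near 0 on an invariant subspace F of the
dependent subspace, a minimum principle would carry a lower bound of this kind out to a fixed ball
with arbitrarily large constant, which is absurd. Under splitting, -log|φ| is exactly additive and
serves directly. For a mixture, the comparison function carries a weight built from the logarithmic
moment, which absorbs the multiplicative error. Hence 1 - |φ| is quadratic along some sequence in F,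
and Fatou's lemma gives a direction of F with finite second moment. Applied to the complement of the
directions already found, this shows that all dependent directions have finite second moment
(`IsMixture.dep_le_secondMoment`).

Gaussianity. The covariance of the dependent part is invariant under T. Polarizing and taking a
trace turns this into a vanishing mean of squared off-diagonal blocks, so the covariance splits
almost surely. The Gaussian characteristic function γ with the same mean and covariance then splits
too, |φ - γ| is subharmonic, and it is o(‖x‖²) at 0. It is therefore below ε‖x‖² + C‖x‖⁴, hence
below ε‖x‖² for every ε.

Independence. Let ψ be the product of the characteristic functions of the components. |φ - ψ| is
subharmonic, and it is bounded by functions recording that two components of x are nonzero at once.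
These contract, because distinct independent subspaces are separated with positive probability and
dependent vectors leave the side of an independent subspace with positive probability
(`IsMixture.charFun_eq_prodChar`). Conversely, each factor of ψ splits along almost every E. -/

theorem starProjection_add_orthogonal (E : Subsp n) (x : Euc n) :
    E.starProjection x + (Eᗮ : Subsp n).starProjection x = x :=
  E.starProjection_add_starProjection_orthogonal x

theorem norm_sq_starProjection_add (E : Subsp n) (x : Euc n) :
    ‖E.starProjection x‖ ^ 2 + ‖(Eᗮ : Subsp n).starProjection x‖ ^ 2 = ‖x‖ ^ 2 :=
  (E.norm_sq_eq_add_norm_sq_starProjection (x := x)).symm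

theorem starProjection_eq_zero_of_le_orthogonal {E F : Subsp n} (h : F ≤ Eᗮ) {x : Euc n}
    (hx : x ∈ F) : E.starProjection x = 0 :=
  (Submodule.starProjection_apply_eq_zero_iff _).2 (h hx)

theorem measurable_starProjection_apply (x : Euc n) :
    Measurable fun E : Subsp n => E.starProjection x :=
  (continuous_starProjection_subsp.clm_apply continuous_const).measurable

theorem measurable_starProjection_orthogonal_apply (x : Euc n) :
    Measurable fun E : Subsp n => (Eᗮ : Subsp n).starProjection x :=
  (continuous_starProjection_orthogonal_subsp.clm_apply continuous_const).measurable

theorem marginalProd_eq_map (μ : Measure (Euc n)) [IsProbabilityMeasure μ] (E : Subsp n) :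
    marginalProd μ E = (μ.prod μ).map fun q : Euc n × Euc n =>
      E.starProjection q.1 + (Eᗮ : Subsp n).starProjection q.2 := by
  unfold marginalProd marginal
  rw [Measure.map_prod_map _ _ (by fun_prop) (by fun_prop), Measure.map_map (by fun_prop)
    (by fun_prop)]
  rfl

instance isProbabilityMeasure_marginal (μ : Measure (Euc n)) [IsProbabilityMeasure μ]
    (E : Subsp n) : IsProbabilityMeasure (marginal μ E) :=
  Measure.isProbabilityMeasure_map (by fun_prop)

instance isProbabilityMeasure_marginalProd (μ : Measure (Euc n)) [IsProbabilityMeasure μ]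
    (E : Subsp n) : IsProbabilityMeasure (marginalProd μ E) :=
  Measure.isProbabilityMeasure_map (by fun_prop)

theorem charFun_map_starProjection (μ : Measure (Euc n)) (E : Subsp n) (y : Euc n) :
    charFun (μ.map E.starProjection) y = charFun μ (E.starProjection y) := by
  rw [charFun_apply, charFun_apply, integral_map (by fun_prop) (by fun_prop)]
  simp_rw [E.inner_starProjection_left_eq_right]

theorem charFun_marginalProd (μ : Measure (Euc n)) [IsProbabilityMeasure μ] (E : Subsp n)
    (x : Euc n) : charFun (marginalProd μ E) x =
      charFun μ (E.starProjection x) * charFun μ ((Eᗮ : Subsp n).starProjection x) := by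
  rw [marginalProd_eq_map, charFun_apply, charFun_apply, charFun_apply,
    integral_map (by fun_prop) (by fun_prop), ← integral_prod_mul]
  congr with q
  rw [inner_add_left, E.inner_starProjection_left_eq_right,
    (Eᗮ).inner_starProjection_left_eq_right, ← Complex.exp_add]
  push_cast
  ring_nf

theorem splitsAlong_iff_charFun (μ : Measure (Euc n)) [IsProbabilityMeasure μ] (E : Subsp n) :
    SplitsAlong μ E ↔ ∀ x, charFun μ x =
      charFun μ (E.starProjection x) * charFun μ ((Eᗮ : Subsp n).starProjection x) := by
  simp_rw [← charFun_marginalProd]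
  exact ⟨fun h x => congrArg (fun ν => charFun ν x) h,
    fun h => Measure.ext_of_charFun (funext h)⟩

theorem SplitsWrt.isMixture {μ : Measure (Euc n)} [IsProbabilityMeasure μ]
    {ξ : Measure (Subsp n)} [IsProbabilityMeasure ξ] (h : SplitsWrt μ ξ) : IsMixture μ ξ := by
  unfold IsMixture
  ext s hs
  rw [Measure.bind_apply hs (measurable_marginalProd μ).aemeasurable]
  have : (fun E => marginalProd μ E s) =ᵐ[ξ] fun _ => μ s := by
    filter_upwards [h] with E hE
    rw [← hE]
  rw [lintegral_congr_ae this]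
  simp

theorem IsMixture.lintegral_eq {μ : Measure (Euc n)} [IsProbabilityMeasure μ]
    {ξ : Measure (Subsp n)} (h : IsMixture μ ξ) {f : Euc n → ℝ≥0∞} (hf : Measurable f) :
    ∫⁻ x, f x ∂μ = ∫⁻ E : Subsp n, ∫⁻ q : Euc n × Euc n,
      f (E.starProjection q.1 + (Eᗮ : Subsp n).starProjection q.2) ∂(μ.prod μ) ∂ξ := by
  conv_lhs => rw [h]
  rw [Measure.lintegral_bind (measurable_marginalProd μ).aemeasurable hf.aemeasurable]
  refine lintegral_congr fun E => ?_
  rw [marginalProd_eq_map, lintegral_map hf (by fun_prop)]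

theorem IsMixture.charFun_eq {μ : Measure (Euc n)} [IsProbabilityMeasure μ]
    {ξ : Measure (Subsp n)} [IsProbabilityMeasure ξ] (h : IsMixture μ ξ) (x : Euc n) :
    charFun μ x = ∫ E : Subsp n, charFun μ (E.starProjection x) *
      charFun μ ((Eᗮ : Subsp n).starProjection x) ∂ξ := by
  simp_rw [← charFun_marginalProd]
  let κ : Kernel (Subsp n) (Euc n) := ⟨marginalProd μ, measurable_marginalProd μ⟩
  have hκ : μ = (κ ∘ₖ Kernel.const Unit ξ) () := by
    rw [Kernel.comp_apply]
    exact h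
  conv_lhs => rw [hκ]
  rw [charFun_apply, Kernel.integral_comp]
  · rfl
  · rw [← hκ]
    refine Integrable.of_bound (by fun_prop) 1 (.of_forall fun y => ?_)
    exact (Complex.norm_exp_ofReal_mul_I _).le

/-! ### Position of a generic subspace relative to the independent decomposition -/

/-- A subspace contained in the zero set of `χ_ξ` is almost surely on one side. -/
theorem ae_le_or_le_orthogonal (ξ : Measure (Subsp n)) [IsProbabilityMeasure ξ] {F : Subsp n}
    (hF : ∀ x ∈ F, chi ξ x = 0) : ∀ᵐ E ∂ξ, F ≤ E ∨ F ≤ Eᗮ := by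
  by_cases hb : F = ⊥
  · exact .of_forall fun E => Or.inl (hb ▸ bot_le)
  obtain ⟨u, hu, hu0⟩ := Submodule.exists_mem_ne_zero_of_ne_bot hb
  -- Each vector comes with its own null set, so only finitely many vectors are tested: generators v
  -- of F and the sums u + v with one fixed u ≠ 0. By `same_side` these put all of F on the side of
  -- u.
  obtain ⟨s, hs⟩ := (IsNoetherian.noetherian F : F.FG)
  have hsF : ∀ v ∈ s, v ∈ F := fun v hv => hs ▸ Submodule.subset_span hv
  have h1 : ∀ᵐ E ∂ξ, ∀ v ∈ s, v ∈ E ∨ v ∈ (Eᗮ : Subsp n) :=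
    (Finset.eventually_all s).2 fun v hv => (chi_eq_zero_iff ξ v).1 (hF v (hsF v hv))
  have h2 : ∀ᵐ E ∂ξ, ∀ v ∈ s, u + v ∈ E ∨ u + v ∈ (Eᗮ : Subsp n) :=
    (Finset.eventually_all s).2 fun v hv =>
      (chi_eq_zero_iff ξ _).1 (hF _ (F.add_mem hu (hsF v hv)))
  filter_upwards [h1, h2, (chi_eq_zero_iff ξ u).1 (hF u hu)] with E h1 h2 h3
  rw [← hs, Submodule.span_le, Submodule.span_le]
  exact h3.imp (fun h v hv => same_side hu0 (h1 v hv) (h2 v hv) h)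
    (fun h v hv => same_side_orthogonal hu0 (h1 v hv) (h2 v hv) h)

/-- `E` is compatible with the independent decomposition: every independent subspace lies in `E`
or in its orthogonal complement. -/
def Compatible (ξ : Measure (Subsp n)) (E : Subsp n) : Prop :=
  ∀ F ∈ independentSubspaces ξ, F ≤ E ∨ F ≤ Eᗮ

theorem ae_compatible (ξ : Measure (Subsp n)) [IsProbabilityMeasure ξ] :
    ∀ᵐ E ∂ξ, Compatible ξ E := by
  have := finite_independentSubspaces ξ
  have h : ∀ᵐ E ∂ξ, ∀ F : independentSubspaces ξ, F.1 ≤ E ∨ F.1 ≤ Eᗮ :=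
    ae_all_iff.2 fun F => ae_le_or_le_orthogonal ξ F.2.2.prop
  filter_upwards [h] with E hE F hF using hE ⟨F, hF⟩

theorem Compatible.orthogonal {ξ : Measure (Subsp n)} {E : Subsp n} (h : Compatible ξ E) :
    Compatible ξ Eᗮ := fun F hF => by
  rw [Submodule.orthogonal_orthogonal]
  exact (h F hF).symm

theorem mem_depSubspace_iff {ξ : Measure (Subsp n)} {z : Euc n} :
    z ∈ depSubspace ξ ↔ ∀ F ∈ independentSubspaces ξ, ∀ e ∈ F, ⟪e, z⟫ = 0 := by
  rw [depSubspace, Submodule.mem_orthogonal]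
  refine ⟨fun h F hF e he => h e (le_sSup hF he), fun h e he => ?_⟩
  have : sSup (independentSubspaces ξ) ≤ (Submodule.span ℝ {z})ᗮ :=
    sSup_le fun F hF e he => by
      rw [Submodule.mem_orthogonal_singleton_iff_inner_left]
      exact h F hF e he
  exact Submodule.mem_orthogonal_singleton_iff_inner_left.1 (this he)

/-- P_E is symmetric and acts on each independent subspace as the identity or as zero, so it
preserves the orthogonal complement of their sum. -/
theorem Compatible.starProjection_mem_dep {ξ : Measure (Subsp n)} {E : Subsp n}
    (h : Compatible ξ E) {z : Euc n} (hz : z ∈ depSubspace ξ) :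
    E.starProjection z ∈ depSubspace ξ := by
  rw [mem_depSubspace_iff] at hz ⊢
  intro F hF e he
  rw [← E.inner_starProjection_left_eq_right]
  rcases h F hF with h | h
  · rw [Submodule.starProjection_eq_self_iff.2 (h he)]
    exact hz F hF e he
  · rw [starProjection_eq_zero_of_le_orthogonal h he, inner_zero_left]

theorem starProjection_comm_of_mapsTo {E F : Subsp n}
    (h : ∀ z ∈ F, E.starProjection z ∈ F) (x : Euc n) :
    F.starProjection (E.starProjection x) = E.starProjection (F.starProjection x) := by
  refine Submodule.eq_starProjection_of_mem_of_inner_eq_zero (h _ (F.starProjection_apply_mem x)) ?_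
  intro w hw
  rw [← map_sub, E.inner_starProjection_left_eq_right]
  exact F.starProjection_inner_eq_zero _ _ (h w hw)

theorem Compatible.dep_starProjection_comm {ξ : Measure (Subsp n)} {E : Subsp n}
    (h : Compatible ξ E) (x : Euc n) : (depSubspace ξ).starProjection (E.starProjection x) =
      E.starProjection ((depSubspace ξ).starProjection x) :=
  starProjection_comm_of_mapsTo (fun _ hz => h.starProjection_mem_dep hz) x

theorem starProjection_starProjection_of_le {E F : Subsp n} (h : F ≤ E) (x : Euc n) :
    F.starProjection (E.starProjection x) = F.starProjection x := by
  refine (Submodule.eq_starProjection_of_mem_of_inner_eq_zero (F.starProjection_apply_mem x)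
    fun w hw => ?_)
  rw [← starProjection_add_orthogonal F x, inner_sub_left, E.inner_starProjection_left_eq_right,
    Submodule.starProjection_eq_self_iff.2 (h hw), ← inner_sub_left, map_add,
    Submodule.starProjection_eq_self_iff.2 (F.starProjection_apply_mem x),
    (Submodule.starProjection_apply_eq_zero_iff _).2 (Fᗮ.starProjection_apply_mem x), add_zero,
    add_sub_cancel_left]
  exact (Submodule.mem_orthogonal' _ _).1 (Fᗮ.starProjection_apply_mem x) w hw

theorem starProjection_starProjection_of_le_orthogonal {E F : Subsp n} (h : F ≤ Eᗮ) (x : Euc n) :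
    F.starProjection (E.starProjection x) = 0 := by
  rw [Submodule.starProjection_apply_eq_zero_iff, Submodule.mem_orthogonal]
  intro u hu
  exact (Submodule.mem_orthogonal' _ _).1 (h hu) _ (E.starProjection_apply_mem x)

theorem chi_pos_of_mem_dep {ξ : Measure (Subsp n)} [IsProbabilityMeasure ξ] {z : Euc n}
    (hz : z ∈ depSubspace ξ) (hz0 : z ≠ 0) : chi ξ z ≠ 0 := by
  intro h
  have hmem : z ∈ {x | chi ξ x = 0} := h
  rw [(isIndependentFamily_independentSubspaces ξ).2.2] at hmem
  simp only [Set.mem_union, Set.mem_singleton_iff, hz0, false_or, Set.mem_iUnion,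
    SetLike.mem_coe, exists_prop] at hmem
  obtain ⟨F, hF, hzF⟩ := hmem
  exact hz0 (inner_self_eq_zero.1 (mem_depSubspace_iff.1 hz F hF z hzF))

/-- Two distinct independent subspaces are separated with positive probability. -/
theorem not_ae_same_side {ξ : Measure (Subsp n)} [IsProbabilityMeasure ξ] {F G : Subsp n}
    (hF : F ∈ independentSubspaces ξ) (hG : G ∈ independentSubspaces ξ) (hne : F ≠ G) :
    ¬ ∀ᵐ E ∂ξ, (F ≤ E ↔ G ≤ E) := by
  intro h
  -- If F and G were almost surely on the same side, F ⊔ G would lie in the zero set, against the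
  -- maximality of both.
  have hsup : ∀ x ∈ F ⊔ G, chi ξ x = 0 := by
    intro x hx
    rw [chi_eq_zero_iff]
    filter_upwards [h, ae_compatible ξ] with E hE hc
    by_cases hFE : F ≤ E
    · exact Or.inl (sup_le hFE (hE.1 hFE) hx)
    · exact Or.inr (sup_le ((hc F hF).resolve_left hFE)
        ((hc G hG).resolve_left fun hGE => hFE (hE.2 hGE)) hx)
  exact hne ((hF.2.eq_of_le hsup le_sup_left).trans (hG.2.eq_of_le hsup le_sup_right).symm)

open Classical in
/-- The projection to that one of `E`, `E^⊥` on whose side `F` lies. -/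
noncomputable def sideProj (F E : Subsp n) : Euc n →L[ℝ] Euc n :=
  if F ≤ E then E.starProjection else (Eᗮ : Subsp n).starProjection

/-- A nonzero dependent vector leaves the side of an independent subspace with positive
probability. -/
theorem not_ae_sideProj_eq_self {ξ : Measure (Subsp n)} [IsProbabilityMeasure ξ] {F : Subsp n}
    {z : Euc n} (hz : z ∈ depSubspace ξ) (hz0 : z ≠ 0) :
    ¬ ∀ᵐ E ∂ξ, sideProj F E z = z := by
  intro h
  refine chi_pos_of_mem_dep hz hz0 ((chi_eq_zero_iff ξ z).2 ?_)
  filter_upwards [h] with E hE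
  unfold sideProj at hE
  split_ifs at hE
  · exact Or.inl (Submodule.starProjection_eq_self_iff.1 hE)
  · exact Or.inr (Submodule.starProjection_eq_self_iff.1 hE)

/-- The set is closed, each condition P_E x = x being closed in E; the intersection over x may
therefore be uncountable. -/
theorem measurableSet_le (F : Subsp n) : MeasurableSet {E : Subsp n | F ≤ E} := by
  have : {E : Subsp n | F ≤ E} = ⋂ x ∈ F, {E : Subsp n | E.starProjection x = x} := by
    ext E
    simp only [Set.mem_ofPred_eq, Set.mem_iInter, Submodule.starProjection_eq_self_iff]
    rfl
  rw [this]
  refine (isClosed_biInter fun x _ => ?_).measurableSet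
  exact isClosed_eq (continuous_starProjection_subsp.clm_apply continuous_const) continuous_const

theorem measurable_sideProj_apply (F : Subsp n) (z : Euc n) :
    Measurable fun E : Subsp n => sideProj F E z := by
  classical
  have : (fun E : Subsp n => sideProj F E z) = fun E => if F ≤ E then E.starProjection z
      else (Eᗮ : Subsp n).starProjection z := by
    funext E
    unfold sideProj
    split_ifs <;> rfl
  rw [this]
  exact Measurable.ite (measurableSet_le F) (measurable_starProjection_apply z)
    (measurable_starProjection_orthogonal_apply z)

theorem norm_sideProj_apply_le (F E : Subsp n) (z : Euc n) : ‖sideProj F E z‖ ≤ ‖z‖ := by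
  unfold sideProj
  split_ifs <;> exact Submodule.norm_starProjection_apply_le _ z

theorem norm_sideProj_apply_eq_iff (F E : Subsp n) (z : Euc n) :
    ‖sideProj F E z‖ = ‖z‖ ↔ sideProj F E z = z := by
  unfold sideProj
  split_ifs <;>
    rw [Submodule.starProjection_eq_self_iff, Submodule.mem_iff_norm_starProjection]

/-! ### Contraction estimates on the dependent subspace -/

/-- A continuous positively homogeneous function which is positive on the nonzero vectors of a
subspace is bounded below by a multiple of the corresponding power of the norm. -/
theorem exists_pos_mul_norm_pow_le {F : Subsp n} {f : Euc n → ℝ} {k : ℕ} (hf : Continuous f)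
    (hhom : ∀ c : ℝ, 0 ≤ c → ∀ x, f (c • x) = c ^ k * f x) (hk : k ≠ 0)
    (hpos : ∀ x ∈ F, x ≠ 0 → 0 < f x) :
    ∃ c : ℝ, 0 < c ∧ ∀ x ∈ F, c * ‖x‖ ^ k ≤ f x := by
  have h0 : f 0 = 0 := by simpa [hk] using hhom 0 le_rfl 0
  have hK : IsCompact ((F : Set (Euc n)) ∩ Metric.sphere 0 1) :=
    (isCompact_sphere 0 1).inter_left F.closed_of_finiteDimensional
  rcases Set.eq_empty_or_nonempty ((F : Set (Euc n)) ∩ Metric.sphere 0 1) with he | hne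
  · refine ⟨1, one_pos, fun x hx => ?_⟩
    by_cases hx0 : x = 0
    · simp [hx0, h0, hk]
    · have : ‖x‖⁻¹ • x ∈ ((F : Set (Euc n)) ∩ Metric.sphere 0 1) :=
        ⟨F.smul_mem _ hx, by simp [norm_smul, hx0]⟩
      simp [he] at this
  · obtain ⟨y, hy, hmin⟩ := hK.exists_isMinOn hne hf.continuousOn
    refine ⟨f y, hpos y hy.1 (by rintro rfl; simpa using hy.2), fun x hx => ?_⟩
    by_cases hx0 : x = 0
    · simp [hx0, h0, hk]
    · have hn : ‖x‖ ≠ 0 := norm_ne_zero_iff.2 hx0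
      have hm : ‖x‖⁻¹ • x ∈ ((F : Set (Euc n)) ∩ Metric.sphere 0 1) :=
        ⟨F.smul_mem _ hx, by simp [norm_smul, hx0]⟩
      have h1 : f y ≤ f (‖x‖⁻¹ • x) := hmin hm
      have h2 : f x = ‖x‖ ^ k * f (‖x‖⁻¹ • x) := by
        rw [← hhom _ (norm_nonneg x), smul_inv_smul₀ hn]
      rw [h2, mul_comm]
      gcongr

/-- If a and b are the two components of x, then ‖a‖⁴ + ‖b‖⁴ = ‖x‖⁴ - 2‖a‖²‖b‖². The mean of
‖a‖²‖b‖² is continuous and homogeneous of degree 4. It vanishes exactly where χ_ξ does, so on the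
dependent subspace compactness bounds it below by c‖x‖⁴. -/
theorem exists_fourth_power_contraction (ξ : Measure (Subsp n)) [IsProbabilityMeasure ξ] :
    ∃ ρ : ℝ≥0∞, ρ < 1 ∧ ∀ x ∈ depSubspace ξ, ∫⁻ E : Subsp n, (‖E.starProjection x‖ₑ ^ 4 +
      ‖(Eᗮ : Subsp n).starProjection x‖ₑ ^ 4) ∂ξ ≤ ρ * ‖x‖ₑ ^ 4 := by
  set g : Euc n → Subsp n → ℝ := fun x E =>
    ‖E.starProjection x‖ ^ 2 * ‖(Eᗮ : Subsp n).starProjection x‖ ^ 2 with hg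
  have hgE : ∀ x, Continuous (g x) := fun x =>
    ((continuous_starProjection_subsp.clm_apply continuous_const).norm.pow 2).mul
      ((continuous_starProjection_orthogonal_subsp.clm_apply continuous_const).norm.pow 2)
  have hg0 : ∀ x E, 0 ≤ g x E := fun x E => by positivity
  have hgb : ∀ x E, g x E ≤ ‖x‖ ^ 2 * ‖x‖ ^ 2 := fun x E => by
    have := Submodule.norm_starProjection_apply_le E x
    have := Submodule.norm_starProjection_apply_le Eᗮ x
    simp only [hg]
    gcongr
  have hint : ∀ x, Integrable (g x) ξ := fun x =>
    Integrable.of_bound (hgE x).measurable.aestronglyMeasurable (‖x‖ ^ 2 * ‖x‖ ^ 2)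
      (.of_forall fun E => by rw [Real.norm_of_nonneg (hg0 x E)]; exact hgb x E)
  have hcont : Continuous fun x => ∫ E, g x E ∂ξ := by
    refine continuous_iff_continuousAt.2 fun x => ?_
    refine continuousAt_of_dominated (bound := fun _ => (‖x‖ + 1) ^ 2 * (‖x‖ + 1) ^ 2)
      (.of_forall fun y => (hint y).1) ?_ (integrable_const _) (.of_forall fun E => ?_)
    · filter_upwards [Metric.ball_mem_nhds x one_pos] with y hy
      refine .of_forall fun E => ?_
      rw [Real.norm_of_nonneg (hg0 y E)]
      have : ‖y‖ ≤ ‖x‖ + 1 := by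
        rw [mem_ball_iff_norm] at hy
        linarith [norm_sub_norm_le y x]
      exact (hgb y E).trans (by gcongr)
    · simp only [hg]
      fun_prop
  have hhom : ∀ c : ℝ, 0 ≤ c → ∀ x, ∫ E, g (c • x) E ∂ξ = c ^ 4 * ∫ E, g x E ∂ξ := by
    intro a ha x
    simp only [hg, map_smul, norm_smul, Real.norm_of_nonneg ha]
    rw [← integral_const_mul]
    congr with E
    ring
  have hpos : ∀ x ∈ depSubspace ξ, x ≠ 0 → 0 < ∫ E, g x E ∂ξ := by
    intro x hx hx0
    refine lt_of_le_of_ne (integral_nonneg (hg0 x)) fun h => chi_pos_of_mem_dep hx hx0 ?_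
    rw [eq_comm, integral_eq_zero_iff_of_nonneg (hg0 x) (hint x)] at h
    rw [chi_eq_zero_iff]
    filter_upwards [h] with E hE
    simp only [hg, Pi.zero_apply, mul_eq_zero, pow_eq_zero_iff two_ne_zero, norm_eq_zero,
      Submodule.starProjection_apply_eq_zero_iff, Submodule.orthogonal_orthogonal] at hE
    exact hE.symm
  obtain ⟨c, hc, hcx⟩ := exists_pos_mul_norm_pow_le (F := depSubspace ξ)
    hcont hhom (by norm_num) hpos
  -- If 2c > 1, which occurs for a trivial dependent subspace, `ENNReal.ofReal` truncates to 0 and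
  -- the estimate still holds.
  refine ⟨ENNReal.ofReal (1 - 2 * c), ?_, fun x hx => ?_⟩
  · rw [ENNReal.ofReal_lt_one]; linarith
  · have hpt : ∀ E : Subsp n, ‖E.starProjection x‖ₑ ^ 4 + ‖(Eᗮ : Subsp n).starProjection x‖ₑ ^ 4
        = ENNReal.ofReal (‖x‖ ^ 4 - 2 * g x E) := by
      intro E
      rw [← ofReal_norm, ← ofReal_norm, ← ENNReal.ofReal_pow (norm_nonneg _),
        ← ENNReal.ofReal_pow (norm_nonneg _), ← ENNReal.ofReal_add (by positivity) (by positivity)]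
      congr 1
      have := norm_sq_starProjection_add E x
      simp only [hg]
      rw [show ‖x‖ ^ 4 = (‖x‖ ^ 2) ^ 2 by ring, ← this]
      ring
    simp_rw [hpt]
    rw [← ofReal_integral_eq_lintegral_ofReal]
    · rw [integral_sub (integrable_const _) ((hint x).const_mul 2), integral_const_mul]
      simp only [integral_const, probReal_univ, one_smul]
      rw [← ofReal_norm, ← ENNReal.ofReal_pow (norm_nonneg _),
        ← ENNReal.ofReal_mul' (by positivity)]
      refine ENNReal.ofReal_le_ofReal ?_
      have := hcx x hx
      linarith
    · exact (integrable_const _).sub ((hint x).const_mul 2)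
    · refine .of_forall fun E => ?_
      have := norm_sq_starProjection_add E x
      simp only [hg, Pi.zero_apply]
      rw [show ‖x‖ ^ 4 = (‖x‖ ^ 2) ^ 2 by ring, ← this]
      nlinarith [sq_nonneg (‖E.starProjection x‖ ^ 2),
        sq_nonneg (‖(Eᗮ : Subsp n).starProjection x‖ ^ 2)]

/-- The mean loss of norm is continuous and homogeneous of degree 1. If it vanished at a nonzero
dependent vector, that vector would almost surely stay on the side of F, contrary to
`not_ae_sideProj_eq_self`. -/
theorem exists_sideProj_contraction (ξ : Measure (Subsp n)) [IsProbabilityMeasure ξ]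
    (F : Subsp n) : ∃ ρ : ℝ≥0∞, ρ < 1 ∧ ∀ z ∈ depSubspace ξ,
      ∫⁻ E : Subsp n, ‖sideProj F E z‖ₑ ∂ξ ≤ ρ * ‖z‖ₑ := by
  have hint : ∀ x, Integrable (fun E => ‖sideProj F E x‖) ξ := fun x =>
    Integrable.of_bound (measurable_sideProj_apply F x).norm.aestronglyMeasurable ‖x‖
      (.of_forall fun E => by rw [norm_norm]; exact norm_sideProj_apply_le F E x)
  have hcont : Continuous fun x => ‖x‖ - ∫ E, ‖sideProj F E x‖ ∂ξ := by
    refine continuous_norm.sub (continuous_iff_continuousAt.2 fun x => ?_)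
    refine continuousAt_of_dominated (bound := fun _ => ‖x‖ + 1)
      (.of_forall fun y => (hint y).1) ?_ (integrable_const _) (.of_forall fun E => ?_)
    · filter_upwards [Metric.ball_mem_nhds x one_pos] with y hy
      refine .of_forall fun E => ?_
      rw [norm_norm]
      rw [mem_ball_iff_norm] at hy
      linarith [norm_sub_norm_le y x, norm_sideProj_apply_le F E y]
    · fun_prop
  have hhom : ∀ c : ℝ, 0 ≤ c → ∀ x, ‖c • x‖ - ∫ E, ‖sideProj F E (c • x)‖ ∂ξ =
      c ^ 1 * (‖x‖ - ∫ E, ‖sideProj F E x‖ ∂ξ) := by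
    intro a ha x
    simp only [map_smul, norm_smul, Real.norm_of_nonneg ha, integral_const_mul]
    ring
  have hpos : ∀ x ∈ depSubspace ξ, x ≠ 0 → 0 < ‖x‖ - ∫ E, ‖sideProj F E x‖ ∂ξ := by
    intro x hx hx0
    have h0 : ∀ E, 0 ≤ ‖x‖ - ‖sideProj F E x‖ := fun E =>
      sub_nonneg.2 (norm_sideProj_apply_le F E x)
    have heq : ‖x‖ - ∫ E, ‖sideProj F E x‖ ∂ξ = ∫ E, (‖x‖ - ‖sideProj F E x‖) ∂ξ := by
      rw [integral_sub (integrable_const _) (hint x)]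
      simp
    simp only [heq]
    refine lt_of_le_of_ne (integral_nonneg h0) fun h => not_ae_sideProj_eq_self (F := F) hx hx0 ?_
    rw [eq_comm, integral_eq_zero_iff_of_nonneg h0 ((integrable_const _).sub (hint x))] at h
    filter_upwards [h] with E hE
    rw [← norm_sideProj_apply_eq_iff]
    simp only [Pi.zero_apply] at hE
    linarith
  obtain ⟨c, hc, hcx⟩ := exists_pos_mul_norm_pow_le (F := depSubspace ξ)
    hcont hhom (by norm_num) hpos
  refine ⟨ENNReal.ofReal (1 - c), ?_, fun x hx => ?_⟩
  · rw [ENNReal.ofReal_lt_one]; linarith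
  · simp_rw [← ofReal_norm]
    rw [← ofReal_integral_eq_lintegral_ofReal (hint x) (.of_forall fun E => norm_nonneg _),
      ← ENNReal.ofReal_mul' (norm_nonneg _)]
    refine ENNReal.ofReal_le_ofReal ?_
    have := hcx x hx
    rw [pow_one] at this
    linarith

/-- Iteration principle for functions that are subharmonic for the splitting operator
`u ↦ ∫ (u(P_E x) + u(P_{E^⊥} x)) dξ(E)`. -/
theorem le_of_subharmonic (ξ : Measure (Subsp n)) {D : Set (Euc n)}
    (hD : ∀ x ∈ D, ∀ᵐ E ∂ξ, E.starProjection x ∈ D ∧ (Eᗮ : Subsp n).starProjection x ∈ D)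
    {u N L : Euc n → ℝ≥0∞} {C ρ : ℝ≥0∞} (hNm : Measurable N) (hC : C ≠ ∞) (hρ : ρ < 1)
    (hLtop : ∀ x ∈ D, L x ≠ ∞)
    (hN : ∀ x ∈ D, ∫⁻ E : Subsp n, (N (E.starProjection x) +
      N ((Eᗮ : Subsp n).starProjection x)) ∂ξ ≤ N x)
    (hL : ∀ x ∈ D, ∫⁻ E : Subsp n, (L (E.starProjection x) +
      L ((Eᗮ : Subsp n).starProjection x)) ∂ξ ≤ ρ * L x)
    (hu : ∀ x ∈ D, u x ≤ ∫⁻ E : Subsp n, (u (E.starProjection x) +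
      u ((Eᗮ : Subsp n).starProjection x)) ∂ξ)
    (hle : ∀ x ∈ D, u x ≤ N x + C * L x) : ∀ x ∈ D, u x ≤ N x := by
  -- Inserting the current bound into `hu` reproduces N by `hN` and multiplies the coefficient of L
  -- by ρ.
  have key : ∀ k : ℕ, ∀ x ∈ D, u x ≤ N x + ρ ^ k * C * L x := by
    intro k
    induction k with
    | zero => simpa using hle
    | succ k ih =>
      intro x hx
      have hCk : ρ ^ k * C ≠ ∞ :=
        ENNReal.mul_ne_top (ENNReal.pow_ne_top (hρ.trans ENNReal.one_lt_top).ne) hC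
      calc u x ≤ ∫⁻ E : Subsp n, (u (E.starProjection x) +
            u ((Eᗮ : Subsp n).starProjection x)) ∂ξ := hu x hx
        _ ≤ ∫⁻ E : Subsp n, ((N (E.starProjection x) + N ((Eᗮ : Subsp n).starProjection x)) +
            ρ ^ k * C * (L (E.starProjection x) + L ((Eᗮ : Subsp n).starProjection x))) ∂ξ := by
          refine lintegral_mono_ae ?_
          filter_upwards [hD x hx] with E hE
          refine (add_le_add (ih _ hE.1) (ih _ hE.2)).trans_eq ?_
          ring
        _ ≤ N x + ρ ^ k * C * (ρ * L x) := by
          -- Only N has to be measurable: `lintegral_add_left` asks this of one summand, and a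
          -- finite constant factor leaves the integral of any function.
          have hm : Measurable fun E : Subsp n =>
              N (E.starProjection x) + N ((Eᗮ : Subsp n).starProjection x) :=
            (hNm.comp (measurable_starProjection_apply x)).add
              (hNm.comp (measurable_starProjection_orthogonal_apply x))
          rw [lintegral_add_left hm, lintegral_const_mul' _ _ hCk]
          gcongr
          · exact hN x hx
          · exact hL x hx
        _ = N x + ρ ^ (k + 1) * C * L x := by ring
  intro x hx
  have hlim : Filter.Tendsto (fun k : ℕ => N x + ρ ^ k * (C * L x)) Filter.atTop
      (nhds (N x + 0 * (C * L x))) :=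
    tendsto_const_nhds.add (ENNReal.Tendsto.mul_const
      (ENNReal.tendsto_pow_atTop_nhds_zero_of_lt_one hρ)
      (Or.inr (ENNReal.mul_ne_top hC (hLtop x hx))))
  rw [zero_mul, add_zero] at hlim
  exact ge_of_tendsto' hlim fun k => by rw [← mul_assoc]; exact key k x hx

/-! ### The characteristic function does not leave its maximum faster than quadratically -/

theorem starProjection_orthogonal_mem {E F : Subsp n} {x : Euc n} (hx : x ∈ F)
    (h : E.starProjection x ∈ F) : (Eᗮ : Subsp n).starProjection x ∈ F := by
  rw [eq_sub_of_add_eq' (starProjection_add_orthogonal E x)]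
  exact F.sub_mem hx h

/-- Minimum principle: a quadratically bounded function `w` that is dominated by `h ≥ 0` near the
origin is dominated by `h`, if `(w - h)⁺` is subharmonic for the splitting operator. -/
theorem le_of_posPart_subharmonic {ξ : Measure (Subsp n)} [IsProbabilityMeasure ξ] {F : Subsp n}
    (hF : F ≤ depSubspace ξ) (hinv : ∀ᵐ E ∂ξ, ∀ x ∈ F, E.starProjection x ∈ F)
    {r K δ : ℝ} (hK : 0 ≤ K) (hδ : 0 < δ) {w h : Euc n → ℝ}
    (hh : ∀ x ∈ F, ‖x‖ ≤ r → 0 ≤ h x)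
    (hw : ∀ x ∈ F, ‖x‖ ≤ r → w x ≤ K * ‖x‖ ^ 2)
    (hsmall : ∀ x ∈ F, ‖x‖ ≤ r → ‖x‖ ≤ δ → w x ≤ h x)
    (hu : ∀ x ∈ F, ‖x‖ ≤ r → ENNReal.ofReal (w x - h x) ≤ ∫⁻ E : Subsp n,
      (ENNReal.ofReal (w (E.starProjection x) - h (E.starProjection x)) +
        ENNReal.ofReal (w ((Eᗮ : Subsp n).starProjection x) -
          h ((Eᗮ : Subsp n).starProjection x))) ∂ξ) :
    ∀ x ∈ F, ‖x‖ ≤ r → w x ≤ h x := by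
  obtain ⟨ρ, hρ, hc⟩ := exists_fourth_power_contraction ξ
  -- Take N = 0. The positive part vanishes for ‖x‖ ≤ δ, and for ‖x‖ > δ it is at most K‖x‖² ≤
  -- (K/δ²)‖x‖⁴, a multiple of the contracted function.
  have key := le_of_subharmonic ξ (D := {x | x ∈ F ∧ ‖x‖ ≤ r})
    (u := fun x => ENNReal.ofReal (w x - h x)) (N := fun _ => 0) (L := fun x => ‖x‖ₑ ^ 4)
    (C := ENNReal.ofReal (K / δ ^ 2)) (ρ := ρ) ?_ measurable_const ENNReal.ofReal_ne_top hρ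
    (fun x _ => by simp) (by simp) (fun x hx => hc x (hF hx.1)) (fun x hx => hu x hx.1 hx.2) ?_
  · intro x hx hxr
    have := key x ⟨hx, hxr⟩
    simp only [nonpos_iff_eq_zero, ENNReal.ofReal_eq_zero] at this
    linarith
  · intro x hx
    filter_upwards [hinv] with E hE
    exact ⟨⟨hE x hx.1, (E.norm_starProjection_apply_le x).trans hx.2⟩,
      ⟨starProjection_orthogonal_mem hx.1 (hE x hx.1),
        (Submodule.norm_starProjection_apply_le _ x).trans hx.2⟩⟩
  · rintro x ⟨hx, hxr⟩
    rw [zero_add, ← ofReal_norm, ← ENNReal.ofReal_pow (norm_nonneg _),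
      ← ENNReal.ofReal_mul (by positivity)]
    rcases le_or_gt ‖x‖ δ with hxδ | hxδ
    · rw [ENNReal.ofReal_of_nonpos (sub_nonpos.2 (hsmall x hx hxr hxδ))]
      exact zero_le
    · refine ENNReal.ofReal_le_ofReal ?_
      have h1 := hw x hx hxr
      have h2 := hh x hx hxr
      have h3 : K * ‖x‖ ^ 2 ≤ K / δ ^ 2 * ‖x‖ ^ 4 := by
        have : 1 ≤ ‖x‖ ^ 2 / δ ^ 2 := by
          rw [one_le_div (by positivity)]
          gcongr
        calc K * ‖x‖ ^ 2 = K * ‖x‖ ^ 2 * 1 := by ring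
          _ ≤ K * ‖x‖ ^ 2 * (‖x‖ ^ 2 / δ ^ 2) := by gcongr
          _ = K / δ ^ 2 * ‖x‖ ^ 4 := by ring
      linarith

/-- `1 - |φ|` is at most quadratic along some sequence of nonzero vectors of `F` tending to `0`. -/
def QuadraticAlongSequence (μ : Measure (Euc n)) (F : Subsp n) : Prop :=
  ∃ K : ℝ, ∀ δ > 0, ∃ y ∈ F, y ≠ 0 ∧ ‖y‖ ≤ δ ∧ 1 - ‖charFun μ y‖ < K * ‖y‖ ^ 2

theorem ofReal_max_zero (a : ℝ) : ENNReal.ofReal (max a 0) = ENNReal.ofReal a := by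
  simp

theorem exists_mem_norm_le {F : Subsp n} (hF : F ≠ ⊥) {r : ℝ} (hr : 0 < r) :
    ∃ x ∈ F, x ≠ 0 ∧ ‖x‖ ≤ r := by
  obtain ⟨v, hv, hv0⟩ := Submodule.exists_mem_ne_zero_of_ne_bot hF
  have hn : ‖v‖ ≠ 0 := norm_ne_zero_iff.2 hv0
  refine ⟨(r * ‖v‖⁻¹) • v, F.smul_mem _ hv, smul_ne_zero (by positivity) hv0, ?_⟩
  rw [norm_smul, Real.norm_of_nonneg (by positivity), mul_assoc, inv_mul_cancel₀ hn, mul_one]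

/-- Near 0, where φ has no zero, g = -log|φ| is additive along almost every splitting, just like
‖·‖², and g ≥ 1 - |φ|. If the claim failed, g ≥ K‖y‖² would hold near 0 for every K, and the minimum
principle would extend it to a ball independent of K. No moment assumption enters. -/
theorem SplitsWrt.quadraticAlongSequence {μ : Measure (Euc n)} [IsProbabilityMeasure μ]
    {ξ : Measure (Subsp n)} [IsProbabilityMeasure ξ] (h : SplitsWrt μ ξ) {F : Subsp n}
    (hF : F ≤ depSubspace ξ) (hinv : ∀ᵐ E ∂ξ, ∀ x ∈ F, E.starProjection x ∈ F) (hF0 : F ≠ ⊥) :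
    QuadraticAlongSequence μ F := by
  by_contra hcon
  unfold QuadraticAlongSequence at hcon
  push Not at hcon
  obtain ⟨r, hr, hφ⟩ : ∃ r > 0, ∀ x : Euc n, ‖x‖ ≤ r → charFun μ x ≠ 0 := by
    have : ∀ᶠ x in nhds (0 : Euc n), charFun μ x ≠ 0 := by
      refine (continuous_charFun (μ := μ)).continuousAt.eventually_ne ?_
      simp
    obtain ⟨ε, hε, hball⟩ := Metric.eventually_nhds_iff.1 this
    exact ⟨ε / 2, by positivity, fun x hx => hball (by rw [dist_zero_right]; linarith)⟩
  obtain ⟨x, hx, hx0, hxr⟩ := exists_mem_norm_le hF0 hr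
  have hxn : 0 < ‖x‖ ^ 2 := by positivity
  set g : Euc n → ℝ := fun y => -Real.log ‖charFun μ y‖ with hg
  have hg0 : ∀ y, 0 ≤ g y := fun y =>
    neg_nonneg.2 (Real.log_nonpos (norm_nonneg _) (norm_charFun_le_one y))
  -- With this K, the conclusion K‖x‖² ≤ g x would read g x + 1 ≤ g x.
  set K : ℝ := (g x + 1) / ‖x‖ ^ 2 with hK
  have hK0 : 0 ≤ K := by have := hg0 x; positivity
  obtain ⟨δ, hδ, hsmall⟩ := hcon K
  have key := le_of_posPart_subharmonic hF hinv (r := r) hK0 hδ (w := fun y => K * ‖y‖ ^ 2) (h := g)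
    (fun y _ _ => hg0 y) (fun _ _ _ => le_rfl) (fun y hy hyr hyδ => ?_)
    (fun y hy hyr => ?_) x hx hxr
  · rw [hK, div_mul_cancel₀ _ hxn.ne'] at key
    linarith
  · by_cases hy0 : y = 0
    · simpa [hy0] using hg0 0
    · have h1 := hsmall y hy hy0 hyδ
      have h2 := Real.log_le_sub_one_of_pos (norm_pos_iff.2 (hφ y hyr))
      simp only [hg]
      linarith
  · calc ENNReal.ofReal (K * ‖y‖ ^ 2 - g y)
      _ = ∫⁻ _ : Subsp n, ENNReal.ofReal (K * ‖y‖ ^ 2 - g y) ∂ξ := by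
          simp
      _ ≤ _ := by
        refine lintegral_mono_ae ?_
        filter_upwards [h] with E hE
        rw [splitsAlong_iff_charFun] at hE
        refine le_trans (ENNReal.ofReal_le_ofReal ?_) ENNReal.ofReal_add_le
        have h1 := hφ _ ((E.norm_starProjection_apply_le y).trans hyr)
        have h2 := hφ _ ((Submodule.norm_starProjection_apply_le Eᗮ y).trans hyr)
        simp only [hg]
        rw [hE y, norm_mul, Real.log_mul (norm_ne_zero_iff.2 h1) (norm_ne_zero_iff.2 h2),
          ← norm_sq_starProjection_add E y]
        linarith

/-- The logarithmic moment of the projection to `V`, at scale `r`. -/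
noncomputable def logMoment (μ : Measure (Euc n)) (V : Subsp n) (r : ℝ) : ℝ :=
  ∫ X, Real.log (1 + r * ‖V.starProjection X‖) ∂μ

theorem integrable_log_scale {μ : Measure (Euc n)} {V : Subsp n}
    (hlog : Integrable (fun X => Real.log (1 + ‖V.starProjection X‖)) μ)
    {r : ℝ} (hr : 0 ≤ r) (hr1 : r ≤ 1) :
    Integrable (fun X => Real.log (1 + r * ‖V.starProjection X‖)) μ := by
  refine hlog.mono' (Measurable.aestronglyMeasurable (by fun_prop)) (.of_forall fun X => ?_)
  have h0 := norm_nonneg (V.starProjection X)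
  have : 0 ≤ r * ‖V.starProjection X‖ := by positivity
  rw [Real.norm_of_nonneg (Real.log_nonneg (by linarith))]
  exact Real.log_le_log (by linarith) (by nlinarith)

theorem logMoment_mono {μ : Measure (Euc n)} {V : Subsp n}
    (hlog : Integrable (fun X => Real.log (1 + ‖V.starProjection X‖)) μ)
    {s r : ℝ} (hs : 0 ≤ s) (hsr : s ≤ r) (hr1 : r ≤ 1) : logMoment μ V s ≤ logMoment μ V r := by
  refine integral_mono (integrable_log_scale hlog hs (hsr.trans hr1))
    (integrable_log_scale hlog (hs.trans hsr) hr1) fun X => ?_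
  have h0 := norm_nonneg (V.starProjection X)
  exact Real.log_le_log (by positivity) (by gcongr)

theorem logMoment_nonneg {μ : Measure (Euc n)} {V : Subsp n} {r : ℝ} (hr : 0 ≤ r) :
    0 ≤ logMoment μ V r :=
  integral_nonneg fun X => Real.log_nonneg (by
    have : 0 ≤ r * ‖V.starProjection X‖ := by positivity
    linarith)

theorem exists_logMoment_le {μ : Measure (Euc n)} {V : Subsp n}
    (hlog : Integrable (fun X => Real.log (1 + ‖V.starProjection X‖)) μ) {ε : ℝ} (hε : 0 < ε) :
    ∃ r : ℝ, 0 < r ∧ r ≤ 1 ∧ logMoment μ V r ≤ ε := by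
  have hlim : Filter.Tendsto (logMoment μ V) (nhdsWithin 0 (Set.Ioc 0 1)) (nhds 0) := by
    have h0 : (0 : ℝ) = ∫ X, Real.log (1 + 0 * ‖V.starProjection X‖) ∂μ := by simp
    conv => rhs; rw [h0]
    refine tendsto_integral_filter_of_dominated_convergence _ 
      (.of_forall fun r => Measurable.aestronglyMeasurable (by fun_prop)) ?_ hlog
      (.of_forall fun X => ?_)
    · filter_upwards [self_mem_nhdsWithin] with r hr
      refine .of_forall fun X => ?_
      have h0 := norm_nonneg (V.starProjection X)
      have : 0 ≤ r * ‖V.starProjection X‖ := mul_nonneg hr.1.le h0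
      rw [Real.norm_of_nonneg (Real.log_nonneg (by linarith))]
      exact Real.log_le_log (by linarith) (by nlinarith [hr.2])
    · have : ContinuousAt (fun r : ℝ => Real.log (1 + r * ‖V.starProjection X‖)) 0 :=
        ContinuousAt.log (by fun_prop) (by simp)
      exact this.tendsto.mono_left nhdsWithin_le_nhds
  have hev : ∀ᶠ r in nhdsWithin 0 (Set.Ioc (0 : ℝ) 1),
      logMoment μ V r ≤ ε ∧ r ∈ Set.Ioc (0 : ℝ) 1 :=
    (hlim.eventually (ge_mem_nhds hε)).and self_mem_nhdsWithin
  have : (nhdsWithin (0 : ℝ) (Set.Ioc 0 1)).NeBot := by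
    rw [nhdsWithin_Ioc_eq_nhdsGT one_pos]
    infer_instance
  obtain ⟨r, h1, h2⟩ := hev.exists
  exact ⟨r, h2.1, h2.2, h1⟩

/-- By log u ≤ u - 1 at u = (1 + s)/(1 + t), the difference of logarithms is at least (t - s)/(1 +
t), and t - s ≥ t/4. -/
theorem log_sub_log_ge {t s : ℝ} (hs : 0 ≤ s) (hst : 4 * s ≤ 3 * t) :
    t / (1 + t) ≤ 4 * (Real.log (1 + t) - Real.log (1 + s)) := by
  have ht : 0 ≤ t := by linarith
  have h1 : Real.log ((1 + s) / (1 + t)) ≤ (1 + s) / (1 + t) - 1 :=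
    Real.log_le_sub_one_of_pos (by positivity)
  rw [Real.log_div (by positivity) (by positivity)] at h1
  have h2 : 1 - (1 + s) / (1 + t) = (t - s) / (1 + t) := by
    field_simp
    ring
  have h3 : t / (1 + t) ≤ 4 * ((t - s) / (1 + t)) := by
    rw [← mul_div_assoc]
    gcongr
    linarith
  linarith

theorem min_two_le {t : ℝ} (ht : 0 ≤ t) : min 2 t ≤ 3 * (t / (1 + t)) := by
  rw [← mul_div_assoc, le_div_iff₀ (by positivity)]
  rcases le_total t 2 with h | h
  · rw [min_eq_right h]; nlinarith
  · rw [min_eq_left h]; linarith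

/-- The deviation of the characteristic function from `1` is controlled by an increment of the
logarithmic moment. -/
theorem one_sub_norm_charFun_le {μ : Measure (Euc n)} [IsProbabilityMeasure μ] {V : Subsp n}
    (hlog : Integrable (fun X => Real.log (1 + ‖V.starProjection X‖)) μ)
    {y : Euc n} (hy : y ∈ V) {s r : ℝ} (hs : 0 ≤ s) (hsr : 4 * s ≤ 3 * r) (hyr : ‖y‖ ≤ r)
    (hr1 : r ≤ 1) :
    1 - ‖charFun μ y‖ ≤ 12 * (logMoment μ V r - logMoment μ V s) := by
  have hr : 0 ≤ r := (norm_nonneg y).trans hyr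
  have hint : Integrable (fun X => Complex.exp (⟪X, y⟫ * Complex.I)) μ :=
    Integrable.of_bound (by fun_prop) 1 (.of_forall fun X => (Complex.norm_exp_ofReal_mul_I _).le)
  have hir := integrable_log_scale hlog hr hr1
  have his := integrable_log_scale hlog hs (by linarith)
  have h1 : 1 - ‖charFun μ y‖ ≤ ‖∫ X, (1 - Complex.exp (⟪X, y⟫ * Complex.I)) ∂μ‖ := by
    rw [integral_sub (integrable_const _) hint, ← charFun_apply]
    have := norm_sub_norm_le 1 (charFun μ y)
    simpa using this
  refine h1.trans ((norm_integral_le_of_norm_le ((hir.sub his).const_mul 12)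
    (.of_forall fun X => ?_)).trans_eq ?_)
  · have h0 := norm_nonneg (V.starProjection X)
    have hin : |⟪X, y⟫| ≤ r * ‖V.starProjection X‖ := by
      rw [← Submodule.starProjection_eq_self_iff.2 hy, ← V.inner_starProjection_left_eq_right]
      calc _ ≤ ‖V.starProjection X‖ * ‖y‖ := abs_real_inner_le_norm _ _
        _ ≤ ‖V.starProjection X‖ * r := by gcongr
        _ = _ := mul_comm _ _
    -- With t = r‖P_V X‖, the chain is |1 - e^{i⟪X, y⟫}| ≤ min 2 t ≤ 3t/(1 + t), and the last term
    -- is at most 3·4 = 12 times the increment of the logarithm.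
    have h2 : ‖1 - Complex.exp (⟪X, y⟫ * Complex.I)‖ ≤ min 2 (r * ‖V.starProjection X‖) := by
      refine le_min ?_ ?_
      · refine (norm_sub_le _ _).trans ?_
        rw [Complex.norm_exp_ofReal_mul_I]
        norm_num
      · rw [norm_sub_rev, mul_comm]
        exact Real.norm_exp_I_mul_ofReal_sub_one_le.trans hin
    have h3 := min_two_le (t := r * ‖V.starProjection X‖) (by positivity)
    have h4 := log_sub_log_ge (t := r * ‖V.starProjection X‖) (s := s * ‖V.starProjection X‖)
      (by positivity) (by nlinarith)
    simp only [Pi.sub_apply]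
    linarith
  · rw [integral_const_mul, integral_sub' hir his]
    rfl

/-- Logarithms do not pass through the average over E, so g = 1 - |φ| replaces -log|φ|. For the
product of the values at the two pieces a, b it gives g(a) + g(b) - g(a)g(b), and the last term
spoils additivity. The weight W decreases as ‖y‖ grows; its gain W(b) - W(y) on the shorter piece b
is at least g(a), which is what absorbs the error. -/
theorem IsMixture.quadraticAlongSequence {μ : Measure (Euc n)} [IsProbabilityMeasure μ]
    {ξ : Measure (Subsp n)} [IsProbabilityMeasure ξ] (h : IsMixture μ ξ)
    (hlog : Integrable (fun X => Real.log (1 + ‖(depSubspace ξ).starProjection X‖)) μ)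
    {F : Subsp n} (hF : F ≤ depSubspace ξ)
    (hinv : ∀ᵐ E ∂ξ, ∀ x ∈ F, E.starProjection x ∈ F) (hF0 : F ≠ ⊥) :
    QuadraticAlongSequence μ F := by
  by_contra hcon
  unfold QuadraticAlongSequence at hcon
  push Not at hcon
  -- The value 1/24 gives 12·G ≤ 1/2, hence W ≥ 1/2, on the ball of radius r.
  obtain ⟨r, hr, hr1, hG⟩ := exists_logMoment_le hlog (ε := 1 / 24) (by norm_num)
  set G := logMoment μ (depSubspace ξ) with hGdef
  obtain ⟨x, hx, hx0, hxr⟩ := exists_mem_norm_le hF0 hr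
  have hxn : 0 < ‖x‖ ^ 2 := by positivity
  set g : Euc n → ℝ := fun y => 1 - ‖charFun μ y‖ with hg
  have hg0 : ∀ y, 0 ≤ g y := fun y => sub_nonneg.2 (norm_charFun_le_one y)
  have hg1 : ∀ y, g y ≤ 1 := fun y => sub_le_self _ (norm_nonneg _)
  -- This makes K‖x‖²·W x ≥ 2, while g x ≤ 1.
  set K : ℝ := 4 / ‖x‖ ^ 2 with hK
  have hK0 : 0 ≤ K := by positivity
  set W : Euc n → ℝ := fun y => 1 - 12 * G ‖y‖ with hW
  have hW1 : ∀ y, W y ≤ 1 := fun y => by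
    have : 0 ≤ G ‖y‖ := logMoment_nonneg (norm_nonneg y)
    simp only [hW]; linarith
  have hW2 : ∀ y, ‖y‖ ≤ r → 1 / 2 ≤ W y := fun y hy => by
    have : G ‖y‖ ≤ G r := logMoment_mono hlog (norm_nonneg y) hy hr1
    simp only [hW]; linarith
  have hwK : ∀ y, K * ‖y‖ ^ 2 * W y ≤ K * ‖y‖ ^ 2 := fun y =>
    mul_le_of_le_one_right (by positivity) (hW1 y)
  /- the pointwise inequality, with `a` the longer of the two pieces of `y` -/
  have hpt : ∀ y a b : Euc n, ‖y‖ ≤ r → a ∈ F → b ∈ F → ‖a‖ ^ 2 + ‖b‖ ^ 2 = ‖y‖ ^ 2 →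
      ‖b‖ ≤ ‖a‖ → ENNReal.ofReal (K * ‖y‖ ^ 2 * W y - (g a + g b - g a * g b)) ≤
        ENNReal.ofReal (K * ‖a‖ ^ 2 * W a - g a) + ENNReal.ofReal (K * ‖b‖ ^ 2 * W b - g b) := by
    intro y a b hy ha hb hab hba
    have hay : ‖a‖ ≤ ‖y‖ := by
      refine le_of_sq_le_sq ?_ (norm_nonneg y)
      nlinarith [sq_nonneg ‖b‖]
    -- The shorter piece satisfies 2‖b‖² ≤ ‖y‖², and 1/√2 < 3/4; this is the gap between scales that
    -- `one_sub_norm_charFun_le` requires.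
    have hby : 4 * ‖b‖ ≤ 3 * ‖y‖ := by
      refine le_of_sq_le_sq ?_ (by positivity)
      nlinarith [mul_self_le_mul_self (norm_nonneg b) hba, sq_nonneg ‖b‖]
    have hga : g a ≤ W b - W y := by
      have := one_sub_norm_charFun_le hlog (hF ha) (norm_nonneg b) hby hay (hy.trans hr1)
      simp only [hg, hW]
      linarith
    have hWa : W y ≤ W a := by
      have : G ‖a‖ ≤ G ‖y‖ := logMoment_mono hlog (norm_nonneg a) hay (hy.trans hr1)
      simp only [hW]; linarith
    -- Since W b ≤ 1, W b · g a ≤ g a ≤ W b - W y.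
    have hWb : W y ≤ W b * (1 - g a) := by nlinarith [hW1 b, hg0 a]
    have h1 : K * ‖y‖ ^ 2 * W y ≤ K * ‖a‖ ^ 2 * W a + K * ‖b‖ ^ 2 * W b * (1 - g a) := by
      calc K * ‖y‖ ^ 2 * W y = K * ‖a‖ ^ 2 * W y + K * ‖b‖ ^ 2 * W y := by rw [← hab]; ring
        _ ≤ K * ‖a‖ ^ 2 * W a + K * ‖b‖ ^ 2 * (W b * (1 - g a)) := by gcongr
        _ = _ := by ring
    -- By `h1`, the left side is at most (K‖a‖²W a - g a) + (1 - g a)(K‖b‖²W b - g b). As 0 ≤ 1 - g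
    -- a ≤ 1, the two positive parts dominate it.
    have hp1 := le_max_left (K * ‖a‖ ^ 2 * W a - g a) 0
    have hp2 := le_max_left (K * ‖b‖ ^ 2 * W b - g b) 0
    have hp3 := le_max_right (K * ‖b‖ ^ 2 * W b - g b) 0
    rw [← ofReal_max_zero (K * ‖a‖ ^ 2 * W a - g a), ← ofReal_max_zero (K * ‖b‖ ^ 2 * W b - g b),
      ← ENNReal.ofReal_add (le_max_right _ _) (le_max_right _ _)]
    refine ENNReal.ofReal_le_ofReal ?_
    nlinarith [hg0 a, hg1 a, mul_le_mul_of_nonneg_right hp2 (sub_nonneg.2 (hg1 a)),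
      mul_nonneg hp3 (hg0 a)]
  obtain ⟨δ, hδ, hsmall⟩ := hcon K
  have key := le_of_posPart_subharmonic hF hinv (r := r) hK0 hδ (w := fun y => K * ‖y‖ ^ 2 * W y)
    (h := g) (fun y _ _ => hg0 y) (fun y _ _ => hwK y) (fun y hy hyr hyδ => ?_)
    (fun y hy hyr => ?_) x hx hxr
  · have h1 : K * ‖x‖ ^ 2 = 4 := div_mul_cancel₀ _ hxn.ne'
    simp only [h1] at key
    linarith [hW2 x hxr, hg1 x]
  · by_cases hy0 : y = 0
    · simpa [hy0] using hg0 0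
    · exact (hwK y).trans (hsmall y hy hy0 hyδ)
  · have hφint : Integrable (fun E : Subsp n => ‖charFun μ (E.starProjection y) *
        charFun μ ((Eᗮ : Subsp n).starProjection y)‖) ξ := by
      refine Integrable.of_bound (Measurable.aestronglyMeasurable ?_) 1 (.of_forall fun E => ?_)
      · exact (((continuous_charFun (μ := μ)).measurable.comp
          (measurable_starProjection_apply y)).mul ((continuous_charFun (μ := μ)).measurable.comp
          (measurable_starProjection_orthogonal_apply y))).norm
      · rw [norm_norm, norm_mul]
        exact mul_le_one₀ (norm_charFun_le_one _) (norm_nonneg _) (norm_charFun_le_one _)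
    have hint : Integrable (fun E : Subsp n => (K * ‖y‖ ^ 2 * W y - 1) +
        ‖charFun μ (E.starProjection y) * charFun μ ((Eᗮ : Subsp n).starProjection y)‖) ξ :=
      (integrable_const _).add hφint
    have h1 : K * ‖y‖ ^ 2 * W y - g y ≤ ∫ E : Subsp n, ((K * ‖y‖ ^ 2 * W y - 1) +
        ‖charFun μ (E.starProjection y) * charFun μ ((Eᗮ : Subsp n).starProjection y)‖) ∂ξ := by
      rw [integral_add (integrable_const _) hφint]
      have : ‖charFun μ y‖ ≤ ∫ E : Subsp n, ‖charFun μ (E.starProjection y) *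
          charFun μ ((Eᗮ : Subsp n).starProjection y)‖ ∂ξ := by
        rw [h.charFun_eq y]
        exact norm_integral_le_integral_norm _
      simp only [integral_const, probReal_univ, one_smul, hg]
      linarith
    -- The integrand is replaced by its positive part, so that `hpt` applies for each E.
    refine (ENNReal.ofReal_le_ofReal (h1.trans (integral_mono hint hint.pos_part
      fun E => le_max_left _ _))).trans ?_
    rw [ofReal_integral_eq_lintegral_ofReal hint.pos_part (.of_forall fun E => le_max_right _ _)]
    refine lintegral_mono_ae ?_
    filter_upwards [hinv] with E hE
    rw [ofReal_max_zero]
    have ha := hE y hy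
    have hb := starProjection_orthogonal_mem hy ha
    have hab := norm_sq_starProjection_add E y
    have hgg : ∀ c : ℝ, ∀ a b : Euc n,
        c - 1 + ‖charFun μ a * charFun μ b‖ = c - (g a + g b - g a * g b) := by
      intro c a b
      simp only [hg, norm_mul]
      ring
    rw [hgg]
    rcases le_total ‖(Eᗮ : Subsp n).starProjection y‖ ‖E.starProjection y‖ with hle | hle
    · exact hpt y _ _ hyr ha hb hab hle
    · have := hpt y _ _ hyr hb ha (by rw [add_comm]; exact hab) hle
      rwa [mul_comm (g _), add_comm (g _), add_comm (ENNReal.ofReal _)] at this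

/-! ### Second moments on the dependent subspace -/

/-- The subspace of the directions in which `μ` has a finite second moment. -/
def secondMomentSubspace (μ : Measure (Euc n)) : Subsp n where
  carrier := {x | MemLp (fun X => ⟪x, X⟫) 2 μ}
  zero_mem' := by simp
  add_mem' := fun {x y} hx hy => by
    simp only [Set.mem_ofPred_eq, inner_add_left] at *
    exact hx.add hy
  smul_mem' := fun c x hx => by
    simp only [Set.mem_ofPred_eq, real_inner_smul_left] at *
    exact hx.const_mul c

theorem memLp_two_of_lintegral_lt_top {Ω : Type*} [MeasurableSpace Ω] {P : Measure Ω} {f : Ω → ℝ}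
    (hf : Measurable f) (h : ∫⁻ ω, ‖f ω‖ₑ ^ 2 ∂P < ∞) : MemLp f 2 P := by
  rw [memLp_two_iff_integrable_sq hf.aestronglyMeasurable]
  refine ⟨(hf.pow_const 2).aestronglyMeasurable, ?_⟩
  simpa [HasFiniteIntegral, enorm_pow] using h

theorem lintegral_sq_lt_top_of_memLp {Ω : Type*} [MeasurableSpace Ω] {P : Measure Ω} {f : Ω → ℝ}
    (h : MemLp f 2 P) : ∫⁻ ω, ‖f ω‖ₑ ^ 2 ∂P < ∞ := by
  have := h.integrable_sq.2
  simpa [HasFiniteIntegral, enorm_pow] using this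

/-- If a sum of two independent variables is square integrable then so is the first one. -/
theorem memLp_two_of_prod {Ω : Type*} [MeasurableSpace Ω] {P : Measure Ω} [IsProbabilityMeasure P]
    {f g : Ω → ℝ} (hf : Measurable f)
    (h : MemLp (fun q : Ω × Ω => f q.1 + g q.2) 2 (P.prod P)) : MemLp f 2 P := by
  -- By Fubini some section in the second variable is square integrable, and it differs from f by
  -- the constant g y.
  obtain ⟨y, hy⟩ := h.integrable_sq.prod_left_ae.exists
  have h1 : MemLp (fun x => f x + g y) 2 P :=
    (memLp_two_iff_integrable_sq (hf.add_const _).aestronglyMeasurable).2 hy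
  refine (h1.sub (memLp_const (g y))).congr_norm hf.aestronglyMeasurable (.of_forall fun x => ?_)
  simp

/-- The second moment in direction x is the mean over E of that of ⟪P_E x, X⟫ + ⟪P_{E^⊥} x, X'⟫ with
X, X' independent copies. It is thus finite for almost every E, and independence isolates the first
summand. A finite generating set makes the null set independent of x. -/
theorem IsMixture.ae_starProjection_mem_secondMoment {μ : Measure (Euc n)}
    [IsProbabilityMeasure μ] {ξ : Measure (Subsp n)} (h : IsMixture μ ξ) :
    ∀ᵐ E ∂ξ, ∀ x ∈ secondMomentSubspace μ, E.starProjection x ∈ secondMomentSubspace μ := by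
  have key : ∀ x ∈ secondMomentSubspace μ,
      ∀ᵐ E : Subsp n ∂ξ, E.starProjection x ∈ secondMomentSubspace μ := by
    intro x hx
    have hm : Measurable fun X : Euc n => ‖⟪x, X⟫‖ₑ ^ 2 := by fun_prop
    have hlt : ∫⁻ E, ∫⁻ X, ‖⟪x, X⟫‖ₑ ^ 2 ∂(marginalProd μ E) ∂ξ ≠ ∞ := by
      rw [← Measure.lintegral_bind (measurable_marginalProd μ).aemeasurable hm.aemeasurable, ← h]
      exact (lintegral_sq_lt_top_of_memLp hx).ne
    filter_upwards [ae_lt_top ((Measure.measurable_lintegral hm).comp (measurable_marginalProd μ))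
      hlt] with E hE
    rw [Function.comp_apply, marginalProd_eq_map, lintegral_map hm (by fun_prop)] at hE
    refine memLp_two_of_prod (g := fun X => ⟪(Eᗮ : Subsp n).starProjection x, X⟫) (by fun_prop)
      (memLp_two_of_lintegral_lt_top (by fun_prop) ?_)
    simpa only [inner_add_right, Submodule.inner_starProjection_left_eq_right] using hE
  obtain ⟨s, hs⟩ := (IsNoetherian.noetherian (secondMomentSubspace μ) :
    (secondMomentSubspace μ).FG)
  have hsF : ∀ v ∈ s, v ∈ secondMomentSubspace μ := fun v hv => hs ▸ Submodule.subset_span hv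
  filter_upwards [(Finset.eventually_all s).2 fun v hv => key v (hsF v hv)] with E hE
  have : secondMomentSubspace μ ≤
      (secondMomentSubspace μ).comap (E.starProjection : Euc n →ₗ[ℝ] Euc n) := by
    conv_lhs => rw [← hs]
    exact Submodule.span_le.2 hE
  exact fun x hx => this hx

/-- |φ|² is the characteristic function of the difference of two independent copies; take real
parts. -/
theorem integral_one_sub_cos_eq (μ : Measure (Euc n)) [IsProbabilityMeasure μ] (y : Euc n) :
    ∫ q : Euc n × Euc n, (1 - Real.cos ⟪q.1 - q.2, y⟫) ∂(μ.prod μ) = 1 - ‖charFun μ y‖ ^ 2 := by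
  have hc : ((‖charFun μ y‖ ^ 2 : ℝ) : ℂ) = ∫ q : Euc n × Euc n,
      Complex.exp ((⟪q.1 - q.2, y⟫ : ℝ) * Complex.I) ∂(μ.prod μ) := by
    have h1 : ((‖charFun μ y‖ ^ 2 : ℝ) : ℂ) = charFun μ y * charFun μ (-y) := by
      rw [charFun_neg, Complex.mul_conj, Complex.normSq_eq_norm_sq]
    rw [h1, charFun_apply, charFun_apply, ← integral_prod_mul]
    congr with q
    rw [← Complex.exp_add, inner_sub_left, inner_neg_right]
    push_cast
    ring_nf
  have hint : Integrable (fun q : Euc n × Euc n =>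
      Complex.exp ((⟪q.1 - q.2, y⟫ : ℝ) * Complex.I)) (μ.prod μ) :=
    Integrable.of_bound (by fun_prop) 1 (.of_forall fun X => (Complex.norm_exp_ofReal_mul_I _).le)
  have hcos : ∀ t : ℝ, Real.cos t = RCLike.re (Complex.exp (t * Complex.I)) := fun t => by
    simp [Complex.exp_ofReal_mul_I_re]
  have hre := integral_re hint
  rw [← hc] at hre
  simp_rw [← hcos] at hre
  rw [integral_sub (integrable_const _)]
  · rw [hre]
    simp only [integral_const, probReal_univ, one_smul]
    congr 1
  · refine Integrable.of_bound (by fun_prop) 1 (.of_forall fun X => ?_)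
    exact Real.abs_cos_le_one _

/-- If `1 - |φ|` is at most quadratic along a sequence in `F`, then `μ` has a finite second moment
in a limit direction of the sequence. -/
theorem QuadraticAlongSequence.exists_mem_secondMoment {μ : Measure (Euc n)}
    [IsProbabilityMeasure μ] {F : Subsp n} (h : QuadraticAlongSequence μ F) :
    ∃ θ ∈ F, θ ≠ 0 ∧ θ ∈ secondMomentSubspace μ := by
  obtain ⟨K, hK⟩ := h
  choose y hyF hy0 hyδ hyK using fun j : ℕ => hK (1 / ((j : ℝ) + 1)) (by positivity)
  have hn : ∀ j, 0 < ‖y j‖ := fun j => norm_pos_iff.2 (hy0 j)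
  have hcomp : IsCompact ((F : Set (Euc n)) ∩ Metric.sphere 0 1) :=
    (isCompact_sphere 0 1).inter_left F.closed_of_finiteDimensional
  obtain ⟨θ, hθ, k, hk, hlim⟩ := hcomp.tendsto_subseq (x := fun j => ‖y j‖⁻¹ • y j) fun j =>
    ⟨F.smul_mem _ (hyF j), by simp [norm_smul, hy0 j]⟩
  refine ⟨θ, hθ.1, by rintro rfl; simpa using hθ.2, ?_⟩
  have hnorm : Filter.Tendsto (fun j => ‖y (k j)‖) Filter.atTop (nhds 0) :=
    (squeeze_zero (fun j => norm_nonneg _) hyδ tendsto_one_div_add_atTop_nhds_zero_nat).comp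
      hk.tendsto_atTop
  set a : ℕ → Euc n × Euc n → ℝ≥0∞ := fun j q =>
    ENNReal.ofReal ((1 - Real.cos ⟪q.1 - q.2, y (k j)⟫) / ‖y (k j)‖ ^ 2) with ha
  have ham : ∀ j, Measurable (a j) := fun j => by simp only [ha]; fun_prop
  -- Uses 1 - |φ|² ≤ 2(1 - |φ|) ≤ 2K‖y‖².
  have hbound : ∀ j, ∫⁻ q, a j q ∂(μ.prod μ) ≤ ENNReal.ofReal (2 * K) := by
    intro j
    rw [← ofReal_integral_eq_lintegral_ofReal]
    · rw [integral_div, integral_one_sub_cos_eq]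
      refine ENNReal.ofReal_le_ofReal ?_
      rw [div_le_iff₀ (by have := hn (k j); positivity)]
      nlinarith [hyK (k j), norm_charFun_le_one (μ := μ) (y (k j)),
        norm_nonneg (charFun μ (y (k j)))]
    · refine Integrable.of_bound (by fun_prop) (2 / ‖y (k j)‖ ^ 2) (.of_forall fun q => ?_)
      rw [Real.norm_of_nonneg (div_nonneg (sub_nonneg.2 (Real.cos_le_one _)) (by positivity))]
      gcongr
      linarith [Real.neg_one_le_cos ⟪q.1 - q.2, y (k j)⟫]
    · exact .of_forall fun q => div_nonneg (sub_nonneg.2 (Real.cos_le_one _)) (by positivity)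
  -- The bound 1 - cos t ≥ 2t²/π² for |t| ≤ π applies eventually, because y (k j) → 0 while q is
  -- fixed.
  have hlower : ∀ q : Euc n × Euc n,
      ENNReal.ofReal (2 / Real.pi ^ 2) * ‖⟪θ, q.1⟫ + -⟪θ, q.2⟫‖ₑ ^ 2 ≤
        Filter.liminf (fun j => a j q) Filter.atTop := by
    intro q
    have hs : Filter.Tendsto (fun j => ⟪q.1 - q.2, ‖y (k j)‖⁻¹ • y (k j)⟫) Filter.atTop
        (nhds ⟪q.1 - q.2, θ⟫) := tendsto_const_nhds.inner hlim
    have ht : Filter.Tendsto (fun j => ENNReal.ofReal (2 / Real.pi ^ 2 *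
        ⟪q.1 - q.2, ‖y (k j)‖⁻¹ • y (k j)⟫ ^ 2)) Filter.atTop
        (nhds (ENNReal.ofReal (2 / Real.pi ^ 2 * ⟪q.1 - q.2, θ⟫ ^ 2))) :=
      ENNReal.tendsto_ofReal ((hs.pow 2).const_mul _)
    have heq : ENNReal.ofReal (2 / Real.pi ^ 2) * ‖⟪θ, q.1⟫ + -⟪θ, q.2⟫‖ₑ ^ 2 =
        ENNReal.ofReal (2 / Real.pi ^ 2 * ⟪q.1 - q.2, θ⟫ ^ 2) := by
      rw [ENNReal.ofReal_mul (by positivity), ← sub_eq_add_neg, ← inner_sub_right,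
        real_inner_comm, ← enorm_pow, ← ofReal_norm, Real.norm_of_nonneg (sq_nonneg _)]
    rw [heq, ← ht.liminf_eq]
    refine Filter.liminf_le_liminf ?_
    have hsm : Filter.Tendsto (fun j => ⟪q.1 - q.2, y (k j)⟫) Filter.atTop (nhds 0) := by
      have h0 : Filter.Tendsto (fun j => y (k j)) Filter.atTop (nhds 0) :=
        tendsto_zero_iff_norm_tendsto_zero.2 hnorm
      simpa using tendsto_const_nhds.inner (𝕜 := ℝ) (x := q.1 - q.2) h0
    filter_upwards [hsm.eventually (Metric.closedBall_mem_nhds 0 Real.pi_pos)] with j hj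
    refine ENNReal.ofReal_le_ofReal ?_
    rw [dist_zero_right, Real.norm_eq_abs] at hj
    have := Real.cos_le_one_sub_mul_cos_sq hj
    have hnj := hn (k j)
    rw [real_inner_smul_right, le_div_iff₀ (by positivity)]
    calc 2 / Real.pi ^ 2 * (‖y (k j)‖⁻¹ * ⟪q.1 - q.2, y (k j)⟫) ^ 2 * ‖y (k j)‖ ^ 2
        = 2 / Real.pi ^ 2 * ⟪q.1 - q.2, y (k j)⟫ ^ 2 := by field_simp
      _ ≤ _ := by linarith
  -- Fatou's lemma bounds the second moment of the symmetrized variable in direction θ;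
  -- `memLp_two_of_prod` then removes the symmetrization.
  have hfin : ENNReal.ofReal (2 / Real.pi ^ 2) *
      ∫⁻ q : Euc n × Euc n, ‖⟪θ, q.1⟫ + -⟪θ, q.2⟫‖ₑ ^ 2 ∂(μ.prod μ) < ∞ := by
    rw [← lintegral_const_mul _ (by fun_prop)]
    calc _ ≤ ∫⁻ q, Filter.liminf (fun j => a j q) Filter.atTop ∂(μ.prod μ) :=
          lintegral_mono hlower
      _ ≤ Filter.liminf (fun j => ∫⁻ q, a j q ∂(μ.prod μ)) Filter.atTop :=
          lintegral_liminf_le ham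
      _ ≤ ENNReal.ofReal (2 * K) := by
          refine Filter.liminf_le_of_frequently_le' (.of_forall hbound)
      _ < ∞ := ENNReal.ofReal_lt_top
  refine memLp_two_of_prod (g := fun X => -⟪θ, X⟫) (by fun_prop)
    (memLp_two_of_lintegral_lt_top (by fun_prop) ?_)
  refine lt_top_iff_ne_top.2 fun htop => ?_
  rw [htop, ENNReal.mul_top (by simp; positivity)] at hfin
  exact lt_irrefl _ hfin

/-- The dependent directions with finite second moment form an almost surely invariant subspace V.
By symmetry of P_E its complement in the dependent subspace is invariant as well. If that complement
were nonzero, `hq` would produce in it a nonzero direction with finite second moment, a vector of V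
∩ V^⊥. -/
theorem IsMixture.dep_le_secondMoment {μ : Measure (Euc n)} [IsProbabilityMeasure μ]
    {ξ : Measure (Subsp n)} [IsProbabilityMeasure ξ] (h : IsMixture μ ξ)
    (hq : ∀ F ≤ depSubspace ξ, (∀ᵐ E ∂ξ, ∀ x ∈ F, E.starProjection x ∈ F) → F ≠ ⊥ →
      QuadraticAlongSequence μ F) : depSubspace ξ ≤ secondMomentSubspace μ := by
  set V := secondMomentSubspace μ ⊓ depSubspace ξ with hV
  have hVinv : ∀ᵐ E : Subsp n ∂ξ, ∀ x ∈ V, E.starProjection x ∈ V := by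
    filter_upwards [h.ae_starProjection_mem_secondMoment, ae_compatible ξ] with E h1 h2 x hx
    exact ⟨h1 x hx.1, h2.starProjection_mem_dep hx.2⟩
  have hFinv : ∀ᵐ E : Subsp n ∂ξ, ∀ x ∈ Vᗮ ⊓ depSubspace ξ,
      E.starProjection x ∈ Vᗮ ⊓ depSubspace ξ := by
    filter_upwards [hVinv, ae_compatible ξ] with E h1 h2 x hx
    refine ⟨(Submodule.mem_orthogonal _ _).2 fun v hv => ?_, h2.starProjection_mem_dep hx.2⟩
    rw [← E.inner_starProjection_left_eq_right]
    exact (Submodule.mem_orthogonal _ _).1 hx.1 _ (h1 v hv)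
  have hbot : Vᗮ ⊓ depSubspace ξ = ⊥ := by
    by_contra hne
    obtain ⟨θ, hθ, hθ0, hθm⟩ := (hq _ inf_le_right hFinv hne).exists_mem_secondMoment
    exact hθ0 (inner_self_eq_zero.1 ((Submodule.mem_orthogonal _ _).1 hθ.1 θ ⟨hθm, hθ.2⟩))
  have := Submodule.sup_orthogonal_inf_of_hasOrthogonalProjection
    (show V ≤ depSubspace ξ from inf_le_right)
  rw [hbot, sup_bot_eq] at this
  rw [← this]
  exact inf_le_left

theorem memLp_starProjection_of_le {μ : Measure (Euc n)} {F : Subsp n}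
    (h : F ≤ secondMomentSubspace μ) : MemLp (fun X => F.starProjection X) 2 μ := by
  refine MemLp.of_eval_piLp fun i => ?_
  have : (fun X => (F.starProjection X) i) =
      fun X => ⟪F.starProjection (EuclideanSpace.basisFun (Fin n) ℝ i), X⟫ := by
    funext X
    rw [F.inner_starProjection_left_eq_right, EuclideanSpace.basisFun_inner]
  rw [this]
  exact h (F.starProjection_apply_mem _)

/-! ### The covariance of a mixture splits -/

theorem isMixture_of_lintegral {μ : Measure (Euc n)} [IsProbabilityMeasure μ]
    {ξ : Measure (Subsp n)}
    (h : ∀ f : Euc n → ℝ≥0∞, Measurable f → ∫⁻ x, f x ∂μ = ∫⁻ E : Subsp n, ∫⁻ q : Euc n × Euc n,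
      f (E.starProjection q.1 + (Eᗮ : Subsp n).starProjection q.2) ∂(μ.prod μ) ∂ξ) :
    IsMixture μ ξ := by
  unfold IsMixture
  ext s hs
  have hm : Measurable (s.indicator (1 : Euc n → ℝ≥0∞)) := measurable_one.indicator hs
  rw [Measure.bind_apply hs (measurable_marginalProd μ).aemeasurable, ← lintegral_indicator_one hs,
    h _ hm]
  refine lintegral_congr fun E => ?_
  rw [← lintegral_indicator_one hs, marginalProd_eq_map, lintegral_map hm (by fun_prop)]

/-- For compatible E, the projection to the dependent subspace commutes with P_E and P_{E^⊥}. -/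
theorem IsMixture.map_dep {μ : Measure (Euc n)} [IsProbabilityMeasure μ]
    {ξ : Measure (Subsp n)} [IsProbabilityMeasure ξ] (h : IsMixture μ ξ) :
    IsMixture (μ.map (depSubspace ξ).starProjection) ξ := by
  have : IsProbabilityMeasure (μ.map (depSubspace ξ).starProjection) :=
    Measure.isProbabilityMeasure_map (by fun_prop)
  refine isMixture_of_lintegral fun f hf => ?_
  rw [lintegral_map hf (by fun_prop), 
    h.lintegral_eq (f := fun X => f ((depSubspace ξ).starProjection X)) (hf.comp (by fun_prop))]
  refine lintegral_congr_ae ?_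
  filter_upwards [ae_compatible ξ] with E hE
  rw [Measure.map_prod_map _ _ (by fun_prop) (by fun_prop), lintegral_map (by fun_prop)
    (by fun_prop)]
  refine lintegral_congr fun q => ?_
  rw [map_add, hE.dep_starProjection_comm, hE.orthogonal.dep_starProjection_comm]
  rfl

theorem inner_covOp (ν : Measure (Euc n)) (x y : Euc n) :
    ⟪covOp ν x, y⟫ = covarianceBilin ν x y :=
  InnerProductSpace.continuousLinearMapOfBilin_apply _ x y

theorem inner_covOp_comm (ν : Measure (Euc n)) (x y : Euc n) :
    ⟪covOp ν x, y⟫ = ⟪x, covOp ν y⟫ := by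
  rw [inner_covOp, real_inner_comm, inner_covOp, covarianceBilin_comm]

theorem lintegral_sq_add_of_centered {Ω : Type*} [MeasurableSpace Ω] {P : Measure Ω}
    [IsProbabilityMeasure P] {f g : Ω → ℝ} (hf : MemLp f 2 P) (hg : MemLp g 2 P)
    (hf0 : ∫ x, f x ∂P = 0) :
    ∫⁻ q : Ω × Ω, ENNReal.ofReal ((f q.1 + g q.2) ^ 2) ∂(P.prod P) =
      ENNReal.ofReal (∫ x, f x ^ 2 ∂P + ∫ x, g x ^ 2 ∂P) := by
  have i1 : Integrable (fun q : Ω × Ω => f q.1 ^ 2) (P.prod P) := hf.integrable_sq.comp_fst P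
  have i2 : Integrable (fun q : Ω × Ω => g q.2 ^ 2) (P.prod P) := hg.integrable_sq.comp_snd P
  have i3 : Integrable (fun q : Ω × Ω => 2 * (f q.1 * g q.2)) (P.prod P) :=
    ((hf.integrable (by norm_num)).mul_prod (hg.integrable (by norm_num))).const_mul 2
  have heq : ∀ q : Ω × Ω, (f q.1 + g q.2) ^ 2 = f q.1 ^ 2 + g q.2 ^ 2 + 2 * (f q.1 * g q.2) :=
    fun q => by ring
  have i4 := i1.fun_add i2
  rw [← ofReal_integral_eq_lintegral_ofReal _ (.of_forall fun q => sq_nonneg _)]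
  · simp_rw [heq]
    rw [integral_add i4 i3, integral_add i1 i2, integral_const_mul, integral_prod_mul,
      hf0, integral_fun_fst (fun x => f x ^ 2), integral_fun_snd (fun x => g x ^ 2)]
    simp
  · simp_rw [heq]
    exact i4.add i3

/-- For every E the vector P_E X + P_{E^⊥} X', with X, X' independent copies, has the same mean m as
ν. Centering thus acts on each piece separately, and independence kills the cross term. -/
theorem IsMixture.covarianceBilin_eq {ν : Measure (Euc n)} [IsProbabilityMeasure ν]
    {ξ : Measure (Subsp n)} [IsProbabilityMeasure ξ] (h : IsMixture ν ξ) (hν : MemLp id 2 ν)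
    (x : Euc n) : ENNReal.ofReal (covarianceBilin ν x x) = ∫⁻ E : Subsp n, ENNReal.ofReal
      (covarianceBilin ν (E.starProjection x) (E.starProjection x) + covarianceBilin ν
        ((Eᗮ : Subsp n).starProjection x) ((Eᗮ : Subsp n).starProjection x)) ∂ξ := by
  set m : Euc n := ν[id] with hm
  have hid : Integrable (fun X : Euc n => X) ν := hν.integrable (by norm_num)
  have hL : ∀ y : Euc n, MemLp (fun X => ⟪y, X - m⟫) 2 ν := fun y =>
    (hν.sub (memLp_const m)).const_inner y
  have h0 : ∀ y : Euc n, ∫ X, ⟪y, X - m⟫ ∂ν = 0 := fun y => by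
    have hsub : Integrable (fun X : Euc n => X - m) ν := hid.sub (integrable_const m)
    rw [integral_inner hsub, integral_sub hid (integrable_const m)]
    simp [hm]
  have hC : ∀ y : Euc n, covarianceBilin ν y y = ∫ X, ⟪y, X - m⟫ ^ 2 ∂ν := fun y => by
    rw [covarianceBilin_apply hν]
    simp_rw [sq]
    rfl
  rw [hC, ofReal_integral_eq_lintegral_ofReal (hL x).integrable_sq
    (.of_forall fun q => sq_nonneg _),
    h.lintegral_eq (by fun_prop)]
  refine lintegral_congr fun E => ?_
  rw [hC, hC, ← lintegral_sq_add_of_centered (hL _) (hL _) (h0 _)]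
  refine lintegral_congr fun q => ?_
  congr 2
  rw [E.inner_starProjection_left_eq_right, (Eᗮ).inner_starProjection_left_eq_right,
    ← inner_add_right]
  congr 1
  nth_rewrite 1 [← starProjection_add_orthogonal E m]
  rw [map_sub, map_sub]
  abel

theorem integrable_bilin_cross (ξ : Measure (Subsp n)) [IsProbabilityMeasure ξ]
    (B : Euc n →L[ℝ] Euc n →L[ℝ] ℝ) (x y : Euc n) :
    Integrable (fun E : Subsp n => B (E.starProjection x) ((Eᗮ : Subsp n).starProjection y)) ξ := by
  refine Integrable.of_bound (Continuous.measurable ?_).aestronglyMeasurable (‖B‖ * ‖x‖ * ‖y‖)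
    (.of_forall fun E => ?_)
  · exact (B.continuous.comp (continuous_starProjection_subsp.clm_apply
      continuous_const)).clm_apply
      (continuous_starProjection_orthogonal_subsp.clm_apply continuous_const)
  · refine (B.le_opNorm₂ _ _).trans ?_
    gcongr
    · exact Submodule.norm_starProjection_apply_le _ _
    · exact Submodule.norm_starProjection_apply_le _ _

theorem bilin_split (B : Euc n →L[ℝ] Euc n →L[ℝ] ℝ) (hB : ∀ x y, B x y = B y x) (E : Subsp n)
    (x : Euc n) : B x x = B (E.starProjection x) (E.starProjection x) +
      B ((Eᗮ : Subsp n).starProjection x) ((Eᗮ : Subsp n).starProjection x) +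
      2 * B (E.starProjection x) ((Eᗮ : Subsp n).starProjection x) := by
  nth_rewrite 1 2 [← starProjection_add_orthogonal E x]
  simp only [map_add, add_apply]
  rw [hB ((Eᗮ : Subsp n).starProjection x) (E.starProjection x)]
  ring

theorem IsMixture.integral_cross_eq_zero {ν : Measure (Euc n)} [IsProbabilityMeasure ν]
    {ξ : Measure (Subsp n)} [IsProbabilityMeasure ξ] (h : IsMixture ν ξ) (hν : MemLp id 2 ν)
    (x : Euc n) : ∫ E : Subsp n, covarianceBilin ν (E.starProjection x)
      ((Eᗮ : Subsp n).starProjection x) ∂ξ = 0 := by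
  have heq : ∀ E : Subsp n, covarianceBilin ν (E.starProjection x) (E.starProjection x) +
      covarianceBilin ν ((Eᗮ : Subsp n).starProjection x) ((Eᗮ : Subsp n).starProjection x) =
      covarianceBilin ν x x -
        2 * covarianceBilin ν (E.starProjection x) ((Eᗮ : Subsp n).starProjection x) := by
    intro E
    rw [bilin_split _ (fun a b => covarianceBilin_comm a b) E x]
    ring
  have hint := (integrable_bilin_cross ξ (covarianceBilin ν) x x).const_mul 2
  have key := h.covarianceBilin_eq hν x
  have hnn : ∀ E : Subsp n, 0 ≤ covarianceBilin ν x x -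
      2 * covarianceBilin ν (E.starProjection x) ((Eᗮ : Subsp n).starProjection x) := fun E => by
    rw [← heq]
    exact add_nonneg (covarianceBilin_self_nonneg _) (covarianceBilin_self_nonneg _)
  have hsub : Integrable (fun E : Subsp n => covarianceBilin ν x x -
      2 * covarianceBilin ν (E.starProjection x) ((Eᗮ : Subsp n).starProjection x)) ξ :=
    (integrable_const _).sub hint
  simp_rw [heq] at key
  rw [← ofReal_integral_eq_lintegral_ofReal hsub (.of_forall hnn),
    ENNReal.ofReal_eq_ofReal_iff (covarianceBilin_self_nonneg _) (integral_nonneg hnn),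
    integral_sub (integrable_const _) hint, integral_const_mul] at key
  simp only [integral_const, probReal_univ, one_smul] at key
  linarith

/-- With P = P_E and Q = P_{E^⊥}, both sides are the trace of P A Q A, by P² = P and cyclicity. -/
theorem sum_inner_eq_sum_norm_sq (A : Euc n →L[ℝ] Euc n) (hA : ∀ x y, ⟪A x, y⟫ = ⟪x, A y⟫)
    (E : Subsp n) (b : OrthonormalBasis (Fin n) ℝ (Euc n)) :
    ∑ i, ⟪A (E.starProjection (b i)), (Eᗮ : Subsp n).starProjection (A (b i))⟫ =
      ∑ i, ‖(Eᗮ : Subsp n).starProjection (A (E.starProjection (b i)))‖ ^ 2 := by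
  set P : Euc n →ₗ[ℝ] Euc n := (E.starProjection : Euc n →ₗ[ℝ] Euc n) with hP
  set Q : Euc n →ₗ[ℝ] Euc n := ((Eᗮ : Subsp n).starProjection : Euc n →ₗ[ℝ] Euc n) with hQ
  set T : Euc n →ₗ[ℝ] Euc n := (A : Euc n →ₗ[ℝ] Euc n) with hT
  have hPP : P * P = P := by
    ext1 x
    exact Submodule.starProjection_eq_self_iff.2 (E.starProjection_apply_mem x)
  have h1 : ∑ i, ⟪A (E.starProjection (b i)), (Eᗮ : Subsp n).starProjection (A (b i))⟫ =
      LinearMap.trace ℝ (Euc n) (P * (T * Q * T)) := by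
    rw [LinearMap.trace_eq_sum_inner _ b]
    refine Finset.sum_congr rfl fun i _ => ?_
    rw [hA, E.inner_starProjection_left_eq_right]
    rfl
  have h2 : ∑ i, ‖(Eᗮ : Subsp n).starProjection (A (E.starProjection (b i)))‖ ^ 2 =
      LinearMap.trace ℝ (Euc n) ((P * (T * Q * T)) * P) := by
    rw [LinearMap.trace_eq_sum_inner _ b]
    refine Finset.sum_congr rfl fun i _ => ?_
    have : ((P * (T * Q * T)) * P) (b i) = E.starProjection (A ((Eᗮ : Subsp n).starProjection
      (A (E.starProjection (b i))))) := rfl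
    rw [this, ← E.inner_starProjection_left_eq_right, ← hA, ← real_inner_self_eq_norm_sq,
      (Eᗮ).inner_starProjection_left_eq_right,
      Submodule.starProjection_eq_self_iff.2 (Submodule.starProjection_apply_mem _ _)]
  rw [h1, h2, LinearMap.trace_mul_comm ℝ (P * (T * Q * T)) P, ← mul_assoc P P, hPP]

/-- The cross term B(P_E x, P_{E^⊥} x) only has mean zero and no definite sign. Its polarization at
the pairs (b i, A (b i)), summed over an orthonormal basis, equals ‖P_{E^⊥} A P_E‖² + ‖P_E A
P_{E^⊥}‖² in the Hilbert–Schmidt norm. This is nonnegative with mean zero, hence zero almost surely.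
-/
theorem IsMixture.ae_covOp_split {ν : Measure (Euc n)} [IsProbabilityMeasure ν]
    {ξ : Measure (Subsp n)} [IsProbabilityMeasure ξ] (h : IsMixture ν ξ) (hν : MemLp id 2 ν) :
    ∀ᵐ E : Subsp n ∂ξ, E.starProjection ∘L covOp ν ∘L (Eᗮ : Subsp n).starProjection = 0 := by
  set A := covOp ν with hA
  set b := EuclideanSpace.basisFun (Fin n) ℝ with hb
  have hpol : ∀ x y : Euc n, ∫ E : Subsp n,
      (covarianceBilin ν (E.starProjection x) ((Eᗮ : Subsp n).starProjection y) +
        covarianceBilin ν (E.starProjection y) ((Eᗮ : Subsp n).starProjection x)) ∂ξ = 0 := by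
    intro x y
    have hi := integrable_bilin_cross ξ (covarianceBilin ν)
    have h1 := h.integral_cross_eq_zero hν (x + y)
    simp only [map_add, add_apply] at h1
    rw [integral_add ((hi x x).fun_add (hi y x)) ((hi x y).fun_add (hi y y)),
      integral_add (hi x x) (hi y x), integral_add (hi x y) (hi y y),
      h.integral_cross_eq_zero hν x, h.integral_cross_eq_zero hν y] at h1
    rw [integral_add (hi x y) (hi y x)]
    linarith
  have hpt : ∀ E : Subsp n,
      ∑ i, (covarianceBilin ν (E.starProjection (b i)) ((Eᗮ : Subsp n).starProjection (A (b i))) +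
        covarianceBilin ν (E.starProjection (A (b i))) ((Eᗮ : Subsp n).starProjection (b i))) =
      ∑ i, ‖(Eᗮ : Subsp n).starProjection (A (E.starProjection (b i)))‖ ^ 2 +
        ∑ i, ‖E.starProjection (A ((Eᗮ : Subsp n).starProjection (b i)))‖ ^ 2 := by
    intro E
    rw [Finset.sum_add_distrib, ← sum_inner_eq_sum_norm_sq A (inner_covOp_comm ν) E b]
    have h2 := sum_inner_eq_sum_norm_sq A (inner_covOp_comm ν) Eᗮ b
    simp only [Submodule.orthogonal_orthogonal] at h2
    rw [← h2]
    congr 1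
    · refine Finset.sum_congr rfl fun i _ => ?_
      rw [inner_covOp]
    · refine Finset.sum_congr rfl fun i _ => ?_
      rw [inner_covOp, covarianceBilin_comm]
  have hi : ∀ i, Integrable (fun E : Subsp n =>
      covarianceBilin ν (E.starProjection (b i)) ((Eᗮ : Subsp n).starProjection (A (b i))) +
        covarianceBilin ν (E.starProjection (A (b i))) ((Eᗮ : Subsp n).starProjection (b i))) ξ :=
    fun i => (integrable_bilin_cross ξ _ _ _).add (integrable_bilin_cross ξ _ _ _)
  have hzero : ∫ E : Subsp n, ∑ i,
      (covarianceBilin ν (E.starProjection (b i)) ((Eᗮ : Subsp n).starProjection (A (b i))) +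
        covarianceBilin ν (E.starProjection (A (b i))) ((Eᗮ : Subsp n).starProjection (b i))) ∂ξ
      = 0 := by
    rw [integral_finsetSum _ fun i _ => hi i]
    exact Finset.sum_eq_zero fun i _ => hpol _ _
  rw [integral_eq_zero_iff_of_nonneg _ (integrable_finsetSum _ fun i _ => hi i)] at hzero
  · filter_upwards [hzero] with E hE
    rw [hpt, Pi.zero_apply] at hE
    have h0 : ∑ i, ‖E.starProjection (A ((Eᗮ : Subsp n).starProjection (b i)))‖ ^ 2 = 0 := by
      have p1 : 0 ≤ ∑ i, ‖(Eᗮ : Subsp n).starProjection (A (E.starProjection (b i)))‖ ^ 2 :=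
        Finset.sum_nonneg fun i _ => sq_nonneg _
      have p2 : 0 ≤ ∑ i, ‖E.starProjection (A ((Eᗮ : Subsp n).starProjection (b i)))‖ ^ 2 :=
        Finset.sum_nonneg fun i _ => sq_nonneg _
      linarith
    rw [Finset.sum_eq_zero_iff_of_nonneg fun i _ => sq_nonneg _] at h0
    refine ContinuousLinearMap.coe_injective (b.toBasis.ext fun i => ?_)
    have := h0 i (Finset.mem_univ i)
    simpa using this
  · intro E
    simp only [hpt]
    exact add_nonneg (Finset.sum_nonneg fun i _ => sq_nonneg _)
      (Finset.sum_nonneg fun i _ => sq_nonneg _)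

theorem covarianceBilin_split_of_covOp {ν : Measure (Euc n)} {E : Subsp n}
    (h : E.starProjection ∘L covOp ν ∘L (Eᗮ : Subsp n).starProjection = 0) (x : Euc n) :
    covarianceBilin ν x x = covarianceBilin ν (E.starProjection x) (E.starProjection x) +
      covarianceBilin ν ((Eᗮ : Subsp n).starProjection x) ((Eᗮ : Subsp n).starProjection x) := by
  rw [bilin_split _ (fun a b => covarianceBilin_comm a b) E x]
  have h1 : covarianceBilin ν (E.starProjection x) ((Eᗮ : Subsp n).starProjection x) = 0 := by
    rw [← inner_covOp, inner_covOp_comm, E.inner_starProjection_left_eq_right]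
    have := congrArg (fun T : Euc n →L[ℝ] Euc n => T x) h
    simp only [ContinuousLinearMap.comp_apply, zero_apply] at this
    rw [this, inner_zero_right]
  rw [h1]
  ring

/-! ### Gaussianity on the dependent subspace -/

/-- The minimum makes the remainder integrable with second moments only. The constant 4 exceeds e,
for |s| ≤ 1, and also covers 2 + |s| + s²/2 ≤ 4s² for |s| ≥ 1. -/
theorem norm_exp_sub_taylor_two_le (s : ℝ) :
    ‖Complex.exp (s * Complex.I) - (1 + s * Complex.I - s ^ 2 / 2)‖ ≤ 4 * (s ^ 2 * min 1 |s|) := by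
  rcases le_total |s| 1 with h | h
  · have h1 := Complex.norm_exp_sub_sum_le_norm_mul_exp (s * Complex.I) 3
    have h2 : ∑ m ∈ Finset.range 3, (s * Complex.I) ^ m / (m.factorial : ℂ) =
        1 + s * Complex.I - s ^ 2 / 2 := by
      simp [Finset.sum_range_succ, mul_pow]
      ring
    have h3 : ‖(s : ℂ) * Complex.I‖ = |s| := by simp
    rw [h2, h3] at h1
    refine h1.trans ?_
    have h4 : Real.exp |s| ≤ 4 := by
      have := Real.exp_le_exp.2 h
      linarith [Real.exp_one_lt_d9]
    rw [min_eq_right h, ← sq_abs s]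
    nlinarith [pow_nonneg (abs_nonneg s) 3]
  · rw [min_eq_left h]
    have h1 : ‖(1 : ℂ) + s * Complex.I - s ^ 2 / 2‖ ≤ 1 + |s| + s ^ 2 / 2 := by
      refine (norm_sub_le _ _).trans (add_le_add ((norm_add_le _ _).trans ?_) ?_)
      · simp
      · simp
    have h2 := norm_sub_le (Complex.exp (s * Complex.I)) (1 + s * Complex.I - s ^ 2 / 2)
    rw [Complex.norm_exp_ofReal_mul_I] at h2
    nlinarith [sq_abs s]

theorem abs_exp_neg_sub_le {c : ℝ} (hc : 0 ≤ c) : |Real.exp (-c) - (1 - c)| ≤ c ^ 2 := by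
  rcases le_total c 1 with h | h
  · have := Real.abs_exp_sub_one_sub_id_le (x := -c) (by rwa [abs_neg, abs_of_nonneg hc])
    rw [neg_sq] at this
    rwa [show Real.exp (-c) - (1 - c) = Real.exp (-c) - 1 - -c by ring]
  · rw [abs_le]
    have h1 := Real.exp_pos (-c)
    have h2 : Real.exp (-c) ≤ 1 := Real.exp_le_one_iff.2 (by linarith)
    constructor <;> nlinarith

/-- The characteristic function of the Gaussian measure with the mean and covariance of `ν`. -/
noncomputable def gaussianChar (ν : Measure (Euc n)) (x : Euc n) : ℂ :=
  Complex.exp ((⟪x, ν[id]⟫ : ℝ) * Complex.I - (covarianceBilin ν x x : ℝ) / 2)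

theorem norm_gaussianChar_le_one (ν : Measure (Euc n)) (x : Euc n) : ‖gaussianChar ν x‖ ≤ 1 := by
  rw [gaussianChar, Complex.norm_exp, Real.exp_le_one_iff]
  have := covarianceBilin_self_nonneg (μ := ν) x
  simp
  linarith

/-- The truncated remainder in the second order expansion of the characteristic function. -/
noncomputable def taylorRemainder (ν : Measure (Euc n)) (r : ℝ) : ℝ :=
  ∫ X, ‖X - ν[id]‖ ^ 2 * min 1 (|r| * ‖X - ν[id]‖) ∂ν

theorem integrable_norm_sub_sq {ν : Measure (Euc n)} [IsProbabilityMeasure ν]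
    (hν : MemLp id 2 ν) (m : Euc n) : Integrable (fun X => ‖X - m‖ ^ 2) ν :=
  (hν.sub (memLp_const m)).norm.integrable_sq

theorem integrable_taylorRemainder {ν : Measure (Euc n)} [IsProbabilityMeasure ν]
    (hν : MemLp id 2 ν) (r : ℝ) :
    Integrable (fun X => ‖X - ν[id]‖ ^ 2 * min 1 (|r| * ‖X - ν[id]‖)) ν := by
  refine (integrable_norm_sub_sq hν ν[id]).mono' (by fun_prop) (.of_forall fun X => ?_)
  rw [Real.norm_of_nonneg (by positivity)]
  exact mul_le_of_le_one_right (by positivity) (min_le_left _ _)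

theorem tendsto_taylorRemainder {ν : Measure (Euc n)} [IsProbabilityMeasure ν]
    (hν : MemLp id 2 ν) : Filter.Tendsto (taylorRemainder ν) (nhds 0) (nhds 0) := by
  have h0 : (0 : ℝ) = taylorRemainder ν 0 := by simp [taylorRemainder]
  conv => rhs; rw [h0]
  refine tendsto_integral_filter_of_dominated_convergence (fun X => ‖X - ν[id]‖ ^ 2)
    (.of_forall fun r => by fun_prop) (.of_forall fun r => .of_forall fun X => ?_)
    (integrable_norm_sub_sq hν _) (.of_forall fun X => ?_)
  · rw [Real.norm_of_nonneg (by positivity)]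
    exact mul_le_of_le_one_right (by positivity) (min_le_left _ _)
  · exact Continuous.tendsto (by fun_prop) 0

/-- Once the phase of the mean is factored out, both functions are compared with 1 - c/2, where c is
the variance in direction x. The factor beside ‖x‖² tends to 0 with x. -/
theorem norm_charFun_sub_gaussianChar_le {ν : Measure (Euc n)} [IsProbabilityMeasure ν]
    (hν : MemLp id 2 ν) (x : Euc n) :
    ‖charFun ν x - gaussianChar ν x‖ ≤
      ‖x‖ ^ 2 * (4 * taylorRemainder ν ‖x‖ + ‖covarianceBilin ν‖ ^ 2 * ‖x‖ ^ 2) := by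
  set m : Euc n := ν[id] with hm
  have hid : Integrable (fun X : Euc n => X) ν := hν.integrable (by norm_num)
  have hsub : Integrable (fun X : Euc n => X - m) ν := hid.sub (integrable_const m)
  have hL : MemLp (fun X => ⟪x, X - m⟫) 2 ν := (hν.sub (memLp_const m)).const_inner x
  have h0 : ∫ X, ⟪x, X - m⟫ ∂ν = 0 := by
    rw [integral_inner hsub, integral_sub hid (integrable_const m)]
    simp [hm]
  set c : ℝ := covarianceBilin ν x x with hc
  have hc0 : 0 ≤ c := covarianceBilin_self_nonneg x
  have hC : c = ∫ X, ⟪x, X - m⟫ ^ 2 ∂ν := by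
    rw [hc, covarianceBilin_apply hν]
    simp_rw [sq]
    rfl
  have hcle : c ≤ ‖covarianceBilin ν‖ * ‖x‖ * ‖x‖ :=
    (le_abs_self _).trans ((covarianceBilin ν).le_opNorm₂ x x)
  have hexp : Integrable (fun X => Complex.exp ((⟪x, X - m⟫ : ℝ) * Complex.I)) ν :=
    Integrable.of_bound (by fun_prop) 1 (.of_forall fun X => (Complex.norm_exp_ofReal_mul_I _).le)
  have hfac : charFun ν x = Complex.exp ((⟪x, m⟫ : ℝ) * Complex.I) *
      ∫ X, Complex.exp ((⟪x, X - m⟫ : ℝ) * Complex.I) ∂ν := by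
    rw [charFun_apply, ← integral_const_mul]
    congr with X
    rw [← Complex.exp_add, inner_sub_right, real_inner_comm x X]
    push_cast
    ring_nf
  have hgau : gaussianChar ν x = Complex.exp ((⟪x, m⟫ : ℝ) * Complex.I) *
      (Real.exp (-(c / 2)) : ℝ) := by
    rw [gaussianChar, sub_eq_add_neg, Complex.exp_add]
    push_cast
    rfl
  have hi1 : Integrable (fun X => ((⟪x, X - m⟫ : ℝ) : ℂ) * Complex.I) ν :=
    (hL.integrable (by norm_num)).ofReal.mul_const _
  have hi2 : Integrable (fun X => ((⟪x, X - m⟫ ^ 2 : ℝ) : ℂ) / 2) ν :=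
    hL.integrable_sq.ofReal.div_const _
  have hi3 : Integrable (fun X => 1 + ((⟪x, X - m⟫ : ℝ) : ℂ) * Complex.I) ν :=
    (integrable_const _).add hi1
  have hi4 : Integrable (fun X => 1 + ((⟪x, X - m⟫ : ℝ) : ℂ) * Complex.I -
      ((⟪x, X - m⟫ ^ 2 : ℝ) : ℂ) / 2) ν := hi3.sub hi2
  have htay : ∫ X, (1 + ((⟪x, X - m⟫ : ℝ) : ℂ) * Complex.I -
      ((⟪x, X - m⟫ ^ 2 : ℝ) : ℂ) / 2) ∂ν = ((1 - c / 2 : ℝ) : ℂ) := by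
    rw [integral_sub hi3 hi2, integral_add (integrable_const _) hi1, integral_mul_const,
      integral_div, integral_complex_ofReal, integral_complex_ofReal, h0, ← hC]
    simp
  have hmain : ‖∫ X, Complex.exp ((⟪x, X - m⟫ : ℝ) * Complex.I) ∂ν - ((1 - c / 2 : ℝ) : ℂ)‖ ≤
      4 * (‖x‖ ^ 2 * taylorRemainder ν ‖x‖) := by
    rw [← htay, ← integral_sub hexp hi4, taylorRemainder, ← integral_const_mul,
      ← integral_const_mul]
    refine norm_integral_le_of_norm_le (((integrable_taylorRemainder hν _).const_mul _).const_mul _)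
      (.of_forall fun X => ?_)
    have h1 := norm_exp_sub_taylor_two_le ⟪x, X - m⟫
    have h2 : |⟪x, X - m⟫| ≤ ‖x‖ * ‖X - m‖ := abs_real_inner_le_norm _ _
    push_cast
    refine h1.trans ?_
    rw [abs_of_nonneg (norm_nonneg x), ← sq_abs ⟪x, X - m⟫]
    calc 4 * (|⟪x, X - m⟫| ^ 2 * min 1 |⟪x, X - m⟫|)
        ≤ 4 * ((‖x‖ * ‖X - m‖) ^ 2 * min 1 (‖x‖ * ‖X - m‖)) := by gcongr
      _ = _ := by ring
  have hlast : ‖((1 - c / 2 : ℝ) : ℂ) - (Real.exp (-(c / 2)) : ℝ)‖ ≤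
      ‖covarianceBilin ν‖ ^ 2 * ‖x‖ ^ 4 := by
    rw [← Complex.ofReal_sub, Complex.norm_real, Real.norm_eq_abs, abs_sub_comm]
    refine (abs_exp_neg_sub_le (by positivity)).trans ?_
    calc (c / 2) ^ 2 ≤ c ^ 2 := by gcongr; linarith
      _ ≤ (‖covarianceBilin ν‖ * ‖x‖ * ‖x‖) ^ 2 := by gcongr
      _ = _ := by ring
  rw [hfac, hgau, ← mul_sub, norm_mul, Complex.norm_exp_ofReal_mul_I, one_mul]
  calc _ ≤ ‖∫ X, Complex.exp ((⟪x, X - m⟫ : ℝ) * Complex.I) ∂ν - ((1 - c / 2 : ℝ) : ℂ)‖ +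
        ‖((1 - c / 2 : ℝ) : ℂ) - (Real.exp (-(c / 2)) : ℝ)‖ :=
        norm_sub_le_norm_sub_add_norm_sub _ _ _
    _ ≤ _ := add_le_add hmain hlast
    _ = _ := by ring

theorem exists_norm_charFun_sub_gaussianChar_le {ν : Measure (Euc n)} [IsProbabilityMeasure ν]
    (hν : MemLp id 2 ν) {ε : ℝ} (hε : 0 < ε) :
    ∃ δ > 0, ∀ x : Euc n, ‖x‖ ≤ δ → ‖charFun ν x - gaussianChar ν x‖ ≤ ε * ‖x‖ ^ 2 := by
  have hlim : Filter.Tendsto (fun r : ℝ => 4 * taylorRemainder ν r +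
      ‖covarianceBilin ν‖ ^ 2 * r ^ 2) (nhds 0) (nhds 0) := by
    have h1 := (tendsto_taylorRemainder hν).const_mul 4
    have h2 : Filter.Tendsto (fun r : ℝ => ‖covarianceBilin ν‖ ^ 2 * r ^ 2) (nhds 0)
        (nhds (‖covarianceBilin ν‖ ^ 2 * 0 ^ 2)) := Continuous.tendsto (by fun_prop) 0
    simpa using h1.add h2
  obtain ⟨δ, hδ, hball⟩ := Metric.eventually_nhds_iff.1 (hlim.eventually (ge_mem_nhds hε))
  refine ⟨δ / 2, by positivity, fun x hx => ?_⟩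
  have h1 := hball (y := ‖x‖) (by rw [dist_zero_right, norm_norm]; linarith)
  refine (norm_charFun_sub_gaussianChar_le hν x).trans ?_
  rw [mul_comm ε]
  gcongr

theorem norm_mul_sub_mul_le {a b c d : ℂ} (hb : ‖b‖ ≤ 1) (hc : ‖c‖ ≤ 1) :
    ‖a * b - c * d‖ ≤ ‖a - c‖ + ‖b - d‖ := by
  calc ‖a * b - c * d‖ = ‖(a - c) * b + c * (b - d)‖ := by ring_nf
    _ ≤ ‖a - c‖ * ‖b‖ + ‖c‖ * ‖b - d‖ := by
      refine (norm_add_le _ _).trans ?_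
      rw [norm_mul, norm_mul]
    _ ≤ ‖a - c‖ * 1 + 1 * ‖b - d‖ := by gcongr
    _ = _ := by ring

theorem gaussianChar_split {ν : Measure (Euc n)} {E : Subsp n}
    (h : E.starProjection ∘L covOp ν ∘L (Eᗮ : Subsp n).starProjection = 0) (x : Euc n) :
    gaussianChar ν x =
      gaussianChar ν (E.starProjection x) * gaussianChar ν ((Eᗮ : Subsp n).starProjection x) := by
  simp only [gaussianChar]
  rw [covarianceBilin_split_of_covOp h x, ← Complex.exp_add]
  nth_rewrite 1 [← starProjection_add_orthogonal E x]
  rw [inner_add_left]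
  push_cast
  ring_nf

/-- A multiplicative function with values in the unit disc deviates from the characteristic
function of a mixture by a subharmonic function. -/
theorem IsMixture.enorm_charFun_sub_le {ν : Measure (Euc n)} [IsProbabilityMeasure ν]
    {ξ : Measure (Subsp n)} [IsProbabilityMeasure ξ] (h : IsMixture ν ξ) {g : Euc n → ℂ}
    (hg : ∀ x, ‖g x‖ ≤ 1) {x : Euc n} (hsplit : ∀ᵐ E : Subsp n ∂ξ,
      g x = g (E.starProjection x) * g ((Eᗮ : Subsp n).starProjection x)) :
    ‖charFun ν x - g x‖ₑ ≤ ∫⁻ E : Subsp n,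
      (‖charFun ν (E.starProjection x) - g (E.starProjection x)‖ₑ +
      ‖charFun ν ((Eᗮ : Subsp n).starProjection x) - g ((Eᗮ : Subsp n).starProjection x)‖ₑ) ∂ξ := by
  have hφ : Integrable (fun E : Subsp n => charFun ν (E.starProjection x) *
      charFun ν ((Eᗮ : Subsp n).starProjection x)) ξ := by
    refine Integrable.of_bound (Measurable.aestronglyMeasurable ?_) 1 (.of_forall fun E => ?_)
    · exact ((continuous_charFun (μ := ν)).measurable.comp
          (measurable_starProjection_apply x)).mul ((continuous_charFun (μ := ν)).measurable.comp
          (measurable_starProjection_orthogonal_apply x))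
    · rw [norm_mul]
      exact mul_le_one₀ (norm_charFun_le_one _) (norm_nonneg _) (norm_charFun_le_one _)
  have h1 : charFun ν x - g x = ∫ E : Subsp n, (charFun ν (E.starProjection x) *
      charFun ν ((Eᗮ : Subsp n).starProjection x) - g x) ∂ξ := by
    rw [integral_sub hφ (integrable_const _), ← h.charFun_eq x]
    simp
  rw [h1]
  refine (enorm_integral_le_lintegral_enorm _).trans (lintegral_mono_ae ?_)
  filter_upwards [hsplit] with E hE
  rw [hE, ← ofReal_norm, ← ofReal_norm, ← ofReal_norm, ← ENNReal.ofReal_add (norm_nonneg _)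
    (norm_nonneg _)]
  exact ENNReal.ofReal_le_ofReal (norm_mul_sub_mul_le (norm_charFun_le_one _) (hg _))

/-- The difference is subharmonic in modulus, bounded by 2, and o(‖x‖²) at 0, hence below ε‖x‖² +
C‖x‖⁴. T preserves the first term and contracts the second, so ε‖x‖² alone is a bound for every ε >
0. -/
theorem IsMixture.charFun_eq_gaussianChar {ν : Measure (Euc n)} [IsProbabilityMeasure ν]
    {ξ : Measure (Subsp n)} [IsProbabilityMeasure ξ] (h : IsMixture ν ξ) (hν : MemLp id 2 ν)
    {x : Euc n} (hx : x ∈ depSubspace ξ) : charFun ν x = gaussianChar ν x := by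
  obtain ⟨ρ, hρ, hc⟩ := exists_fourth_power_contraction ξ
  have key : ∀ ε > 0, ‖charFun ν x - gaussianChar ν x‖ₑ ≤ ENNReal.ofReal ε * ‖x‖ₑ ^ 2 := by
    intro ε hε
    obtain ⟨δ, hδ, hsmall⟩ := exists_norm_charFun_sub_gaussianChar_le hν hε
    refine le_of_subharmonic ξ (D := (depSubspace ξ : Set (Euc n)))
      (u := fun x => ‖charFun ν x - gaussianChar ν x‖ₑ)
      (N := fun x => ENNReal.ofReal ε * ‖x‖ₑ ^ 2) (L := fun x => ‖x‖ₑ ^ 4)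
      (C := ENNReal.ofReal (2 / δ ^ 4)) (ρ := ρ) ?_ (by fun_prop) ENNReal.ofReal_ne_top hρ
      (fun x _ => by simp) ?_ hc ?_ ?_ x hx
    · intro x hx
      filter_upwards [ae_compatible ξ] with E hE
      exact ⟨hE.starProjection_mem_dep hx, hE.orthogonal.starProjection_mem_dep hx⟩
    · intro x _
      have : ∀ E : Subsp n, ENNReal.ofReal ε * ‖E.starProjection x‖ₑ ^ 2 +
          ENNReal.ofReal ε * ‖(Eᗮ : Subsp n).starProjection x‖ₑ ^ 2 =
          ENNReal.ofReal ε * ‖x‖ₑ ^ 2 := by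
        intro E
        rw [← mul_add, ← ofReal_norm, ← ofReal_norm, ← ofReal_norm,
          ← ENNReal.ofReal_pow (norm_nonneg _), ← ENNReal.ofReal_pow (norm_nonneg _),
          ← ENNReal.ofReal_pow (norm_nonneg _), ← ENNReal.ofReal_add (by positivity)
          (by positivity), norm_sq_starProjection_add]
      simp_rw [this]
      simp
    · intro x _
      refine h.enorm_charFun_sub_le (norm_gaussianChar_le_one ν) ?_
      filter_upwards [h.ae_covOp_split hν] with E hE using gaussianChar_split hE x
    · intro x _
      rw [← ofReal_norm, ← ofReal_norm, ← ENNReal.ofReal_pow (norm_nonneg _),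
        ← ENNReal.ofReal_pow (norm_nonneg _), ← ENNReal.ofReal_mul hε.le,
        ← ENNReal.ofReal_mul (by positivity), ← ENNReal.ofReal_add (by positivity) (by positivity)]
      refine ENNReal.ofReal_le_ofReal ?_
      rcases le_or_gt ‖x‖ δ with hxδ | hxδ
      · exact (hsmall x hxδ).trans (le_add_of_nonneg_right (by positivity))
      · have h1 : ‖charFun ν x - gaussianChar ν x‖ ≤ 2 := by
          refine (norm_sub_le _ _).trans ?_
          linarith [norm_charFun_le_one (μ := ν) x, norm_gaussianChar_le_one ν x]
        -- Outside the δ-ball the trivial bound 2 is covered by the quartic term.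
        have h2 : 2 ≤ 2 / δ ^ 4 * ‖x‖ ^ 4 := by
          rw [div_mul_eq_mul_div, le_div_iff₀ (by positivity)]
          gcongr
        have h3 : 0 ≤ ε * ‖x‖ ^ 2 := by positivity
        linarith
  have hle : ∀ ε > 0, ‖charFun ν x - gaussianChar ν x‖ ≤ ε * ‖x‖ ^ 2 := by
    intro ε hε
    have := key ε hε
    rwa [← ofReal_norm, ← ofReal_norm, ← ENNReal.ofReal_pow (norm_nonneg _),
      ← ENNReal.ofReal_mul hε.le, ENNReal.ofReal_le_ofReal_iff (by positivity)] at this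
  have hlim : Filter.Tendsto (fun ε : ℝ => ε * ‖x‖ ^ 2) (nhdsWithin 0 (Set.Ioi 0)) (nhds 0) := by
    have : Filter.Tendsto (fun ε : ℝ => ε * ‖x‖ ^ 2) (nhds 0) (nhds (0 * ‖x‖ ^ 2)) :=
      Continuous.tendsto (by fun_prop) 0
    rw [zero_mul] at this
    exact this.mono_left nhdsWithin_le_nhds
  have h0 : ‖charFun ν x - gaussianChar ν x‖ ≤ 0 :=
    ge_of_tendsto hlim (by filter_upwards [self_mem_nhdsWithin] with ε hε using hle ε hε)
  exact sub_eq_zero.1 (norm_le_zero_iff.1 h0)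

theorem map_starProjection_idem (μ : Measure (Euc n)) (V : Subsp n) :
    (μ.map V.starProjection).map V.starProjection = μ.map V.starProjection := by
  rw [Measure.map_map (by fun_prop) (by fun_prop)]
  congr 1
  ext1 x
  exact Submodule.starProjection_eq_self_iff.2 (V.starProjection_apply_mem x)

/-- The projected measure is its own image under the projection, so its mean and covariance see only
the component of x in V. -/
theorem gaussianChar_starProjection {μ : Measure (Euc n)} [IsProbabilityMeasure μ] {V : Subsp n}
    (hν : MemLp id 2 (μ.map V.starProjection)) (x : Euc n) :
    gaussianChar (μ.map V.starProjection) (V.starProjection x) =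
      gaussianChar (μ.map V.starProjection) x := by
  have : IsProbabilityMeasure (μ.map V.starProjection) :=
    Measure.isProbabilityMeasure_map (by fun_prop)
  set ν := μ.map V.starProjection with hνdef
  have hidem : ν.map V.starProjection = ν := map_starProjection_idem μ V
  have hadj : (V.starProjection).adjoint = V.starProjection :=
    (V.starProjection_isSymmetric).isSelfAdjoint.adjoint_eq
  have hmean : V.starProjection ν[id] = ν[id] := by
    have := V.starProjection.integral_id_map (hν.integrable (by norm_num))
    rw [hidem] at this
    exact this.symm
  have hcov : covarianceBilin ν x x =
      covarianceBilin ν (V.starProjection x) (V.starProjection x) := by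
    conv_lhs => rw [← hidem]
    rw [covarianceBilin_map hν, hadj]
  simp only [gaussianChar]
  rw [hcov, V.inner_starProjection_left_eq_right, hmean]

theorem marginal_eq_map_map (μ : Measure (Euc n)) (V : Subsp n) :
    marginal μ V = (μ.map V.starProjection).map V.orthogonalProjectionOnto := by
  rw [Measure.map_map (by fun_prop) (by fun_prop), marginal]
  congr 1
  ext1 x
  exact (V.orthogonalProjectionOnto_mem_subspace_eq_self (V.orthogonalProjectionOnto x)).symm

theorem map_starProjection_eq_map_marginal (μ : Measure (Euc n)) (V : Subsp n) :
    μ.map V.starProjection = (marginal μ V).map V.subtypeL := by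
  rw [marginal, Measure.map_map (by fun_prop) (by fun_prop)]
  rfl

theorem IsMixture.isGaussian_and_covSplits {μ : Measure (Euc n)} [IsProbabilityMeasure μ]
    {ξ : Measure (Subsp n)} [IsProbabilityMeasure ξ] (h : IsMixture μ ξ)
    (hdep : depSubspace ξ ≤ secondMomentSubspace μ) :
    IsGaussian (marginal μ (depSubspace ξ)) ∧ CovSplits μ (depSubspace ξ) ξ := by
  have : IsProbabilityMeasure (μ.map (depSubspace ξ).starProjection) :=
    Measure.isProbabilityMeasure_map (by fun_prop)
  have hν : MemLp id 2 (μ.map (depSubspace ξ).starProjection) :=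
    (memLp_map_measure_iff (by fun_prop) (by fun_prop)).2 (memLp_starProjection_of_le hdep)
  constructor
  · have hg : IsGaussian (μ.map (depSubspace ξ).starProjection) := by
      refine isGaussian_iff_gaussian_charFun.2
        ⟨(μ.map (depSubspace ξ).starProjection)[id],
        covarianceBilin (μ.map (depSubspace ξ).starProjection),
        isPosSemidef_covarianceBilin, fun t => ?_⟩
      change _ = gaussianChar _ t
      -- Equality is known only at dependent vectors, but both sides depend on t through its
      -- dependent component alone.
      rw [← gaussianChar_starProjection hν, ← h.map_dep.charFun_eq_gaussianChar hν
        (Submodule.starProjection_apply_mem _ t), ← charFun_map_starProjection,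
        map_starProjection_idem]
    rw [marginal_eq_map_map]
    infer_instance
  · unfold CovSplits
    refine integral_eq_zero_of_ae ?_
    filter_upwards [h.map_dep.ae_covOp_split hν] with E hE
    rw [hE, norm_zero, Pi.zero_apply]

/-- A Gaussian dependent marginal whose covariance splits is multiplicative. -/
theorem ae_charFun_split_of_isGaussian {μ : Measure (Euc n)} [IsProbabilityMeasure μ]
    {ξ : Measure (Subsp n)} [IsProbabilityMeasure ξ]
    (hg : IsGaussian (marginal μ (depSubspace ξ))) (hc : CovSplits μ (depSubspace ξ) ξ) :
    ∀ᵐ E : Subsp n ∂ξ, ∀ z ∈ depSubspace ξ, charFun μ z =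
      charFun μ (E.starProjection z) * charFun μ ((Eᗮ : Subsp n).starProjection z) := by
  have hgν : IsGaussian (μ.map (depSubspace ξ).starProjection) := by
    rw [map_starProjection_eq_map_marginal]
    infer_instance
  have hφ : ∀ z ∈ depSubspace ξ,
      charFun μ z = gaussianChar (μ.map (depSubspace ξ).starProjection) z := by
    intro z hz
    rw [gaussianChar, ← hgν.charFun_eq', charFun_map_starProjection,
      Submodule.starProjection_eq_self_iff.2 hz]
  unfold CovSplits at hc
  rw [integral_eq_zero_iff_of_nonneg (fun E => norm_nonneg _)] at hc
  · filter_upwards [hc, ae_compatible ξ] with E hE hcomp z hz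
    rw [hφ z hz, hφ _ (hcomp.starProjection_mem_dep hz),
      hφ _ (hcomp.orthogonal.starProjection_mem_dep hz)]
    exact gaussianChar_split (norm_eq_zero.1 hE) z
  -- A vanishing integral carries information only for an integrable integrand, since otherwise it
  -- is 0 by convention; here the integrand is continuous and bounded.
  · refine Integrable.of_bound (Continuous.measurable ?_).aestronglyMeasurable
      (1 * (‖covOp (μ.map (depSubspace ξ).starProjection)‖ * 1)) (.of_forall fun E => ?_)
    · exact (continuous_starProjection_subsp.clm_comp
        (continuous_const.clm_comp continuous_starProjection_orthogonal_subsp)).norm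
    · rw [norm_norm]
      refine (ContinuousLinearMap.opNorm_comp_le _ _).trans ?_
      gcongr
      · exact Submodule.starProjection_norm_le _
      · refine (ContinuousLinearMap.opNorm_comp_le _ _).trans ?_
        gcongr
        exact Submodule.starProjection_norm_le _

/-! ### Independence of the components -/

/-- The characteristic function of the product of the marginals on the independent subspaces and
on the dependent subspace. -/
noncomputable def prodChar (ξ : Measure (Subsp n)) [IsProbabilityMeasure ξ] (μ : Measure (Euc n))
    (x : Euc n) : ℂ :=
  (∏ α : independentSubspaces ξ, charFun μ (α.1.starProjection x)) *
    charFun μ ((depSubspace ξ).starProjection x)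

theorem integral_exp_inner_marginal (μ : Measure (Euc n)) (F : Subsp n) (x : Euc n) :
    ∫ y : F, Complex.exp ((⟪(y : Euc n), x⟫ : ℝ) * Complex.I) ∂(marginal μ F) =
      charFun μ (F.starProjection x) := by
  rw [marginal, integral_map (by fun_prop) (by fun_prop), charFun_apply]
  congr with X
  rw [← F.inner_starProjection_left_eq_right]
  rfl

theorem charFun_independentProd (ξ : Measure (Subsp n)) [IsProbabilityMeasure ξ]
    (μ : Measure (Euc n)) [IsProbabilityMeasure μ] (x : Euc n) :
    charFun (independentProd ξ μ) x = prodChar ξ μ x := by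
  rw [independentProd, charFun_apply, integral_map (by fun_prop) (by fun_prop), prodChar]
  simp_rw [← integral_exp_inner_marginal]
  rw [← integral_fintype_prod_eq_prod
    (f := fun (α : independentSubspaces ξ) (y : α.1) =>
      Complex.exp ((⟪(y : Euc n), x⟫ : ℝ) * Complex.I)), ← integral_prod_mul]
  congr with p
  rw [← Complex.exp_sum, ← Complex.exp_add, inner_add_left, sum_inner]
  push_cast
  rw [add_mul, Finset.sum_mul]

theorem eq_independentProd_iff (ξ : Measure (Subsp n)) [IsProbabilityMeasure ξ]
    (μ : Measure (Euc n)) [IsProbabilityMeasure μ] :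
    μ = independentProd ξ μ ↔ ∀ x, charFun μ x = prodChar ξ μ x := by
  have : IsProbabilityMeasure (independentProd ξ μ) :=
    Measure.isProbabilityMeasure_map (by fun_prop)
  simp_rw [← charFun_independentProd]
  exact ⟨fun h x => congrArg (fun ν => charFun ν x) h,
    fun h => Measure.ext_of_charFun (funext h)⟩

theorem norm_prodChar_le_one (ξ : Measure (Subsp n)) [IsProbabilityMeasure ξ]
    (μ : Measure (Euc n)) [IsProbabilityMeasure μ] (x : Euc n) : ‖prodChar ξ μ x‖ ≤ 1 := by
  rw [prodChar, norm_mul, norm_prod]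
  exact mul_le_one₀ (Finset.prod_le_one (fun _ _ => norm_nonneg _)
    fun _ _ => norm_charFun_le_one _) (norm_nonneg _) (norm_charFun_le_one _)

/-- Each independent subspace lies on one side of E, so its factor passes intact to that side and
becomes φ(0) = 1 on the other. Only the dependent factor has to split. -/
theorem prodChar_split {ξ : Measure (Subsp n)} [IsProbabilityMeasure ξ] {μ : Measure (Euc n)}
    [IsProbabilityMeasure μ] {E : Subsp n} (hE : Compatible ξ E)
    (hdep : ∀ z ∈ depSubspace ξ, charFun μ z =
      charFun μ (E.starProjection z) * charFun μ ((Eᗮ : Subsp n).starProjection z)) (x : Euc n) :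
    prodChar ξ μ x =
      prodChar ξ μ (E.starProjection x) * prodChar ξ μ ((Eᗮ : Subsp n).starProjection x) := by
  simp only [prodChar]
  rw [hdep _ (Submodule.starProjection_apply_mem _ x), mul_mul_mul_comm, ← Finset.prod_mul_distrib,
    hE.dep_starProjection_comm, hE.orthogonal.dep_starProjection_comm]
  congr 1
  refine Finset.prod_congr rfl fun α _ => ?_
  rcases hE α.1 α.2 with h | h
  · rw [starProjection_starProjection_of_le h, starProjection_starProjection_of_le_orthogonal
      (by rwa [Submodule.orthogonal_orthogonal])]
    simp
  · rw [starProjection_starProjection_of_le h, starProjection_starProjection_of_le_orthogonal h]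
    simp

theorem sum_starProjection_add_dep (ξ : Measure (Subsp n)) [IsProbabilityMeasure ξ] (x : Euc n) :
    ∑ α : independentSubspaces ξ, α.1.starProjection x + (depSubspace ξ).starProjection x = x := by
  set s := ∑ α : independentSubspaces ξ, α.1.starProjection x with hs
  have hmem : x - s ∈ depSubspace ξ := by
    rw [mem_depSubspace_iff]
    intro F hF e he
    have h1 : ⟪e, s⟫ = ⟪e, F.starProjection x⟫ := by
      rw [hs, inner_sum, Finset.sum_eq_single ⟨F, hF⟩ (fun β _ hβ => ?_) (by simp)]
      exact Submodule.isOrtho_iff_inner_eq.1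
        (independentSubspaces_pairwise ξ hF β.2 (fun h => hβ (Subtype.ext h.symm))) e he _
        (Submodule.starProjection_apply_mem _ _)
    rw [inner_sub_right, h1, ← F.inner_starProjection_left_eq_right,
      Submodule.starProjection_eq_self_iff.2 he, sub_self]
  have h2 : (depSubspace ξ).starProjection x = x - s := by
    refine Submodule.eq_starProjection_of_mem_of_inner_eq_zero hmem fun w hw => ?_
    rw [sub_sub_cancel, hs, sum_inner]
    exact Finset.sum_eq_zero fun α _ =>
      mem_depSubspace_iff.1 hw α.1 α.2 _ (Submodule.starProjection_apply_mem _ _)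
  rw [h2, add_sub_cancel]

/-- In directions of V, φ is Lipschitz with constant the first moment of ‖P_V X‖; hence φ(a + z) and
φ(a)φ(z) are both close to φ(a). -/
theorem norm_charFun_add_sub_mul_le {μ : Measure (Euc n)} [IsProbabilityMeasure μ] {V : Subsp n}
    (hV : Integrable (fun X => V.starProjection X) μ) (a : Euc n) {z : Euc n} (hz : z ∈ V) :
    ‖charFun μ (a + z) - charFun μ a * charFun μ z‖ ≤
      2 * (∫ X, ‖V.starProjection X‖ ∂μ) * ‖z‖ := by
  have hexp : ∀ y, Integrable (fun X => Complex.exp ((⟪X, y⟫ : ℝ) * Complex.I)) μ := fun y =>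
    Integrable.of_bound (by fun_prop) 1 (.of_forall fun X => (Complex.norm_exp_ofReal_mul_I _).le)
  have hpt : ∀ X, ‖Complex.exp ((⟪X, z⟫ : ℝ) * Complex.I) - 1‖ ≤
      ‖V.starProjection X‖ * ‖z‖ := by
    intro X
    rw [mul_comm (_ : ℂ)]
    refine Real.norm_exp_I_mul_ofReal_sub_one_le.trans ?_
    rw [← Submodule.starProjection_eq_self_iff.2 hz, ← V.inner_starProjection_left_eq_right,
      Submodule.starProjection_eq_self_iff.2 hz]
    exact abs_real_inner_le_norm _ _
  have h1 : ‖charFun μ z - 1‖ ≤ (∫ X, ‖V.starProjection X‖ ∂μ) * ‖z‖ := by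
    have : charFun μ z - 1 = ∫ X, (Complex.exp ((⟪X, z⟫ : ℝ) * Complex.I) - 1) ∂μ := by
      rw [integral_sub (hexp z) (integrable_const _), ← charFun_apply]
      simp
    rw [this, ← integral_mul_const]
    exact norm_integral_le_of_norm_le (hV.norm.mul_const _) (.of_forall hpt)
  have h2 : ‖charFun μ (a + z) - charFun μ a‖ ≤ (∫ X, ‖V.starProjection X‖ ∂μ) * ‖z‖ := by
    rw [charFun_apply, charFun_apply, ← integral_sub (hexp _) (hexp _), ← integral_mul_const]
    refine norm_integral_le_of_norm_le (hV.norm.mul_const _) (.of_forall fun X => ?_)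
    have : Complex.exp ((⟪X, a + z⟫ : ℝ) * Complex.I) - Complex.exp ((⟪X, a⟫ : ℝ) * Complex.I) =
        Complex.exp ((⟪X, a⟫ : ℝ) * Complex.I) *
          (Complex.exp ((⟪X, z⟫ : ℝ) * Complex.I) - 1) := by
      rw [mul_sub, ← Complex.exp_add, inner_add_right]
      push_cast
      ring_nf
    rw [this, norm_mul, Complex.norm_exp_ofReal_mul_I, one_mul]
    exact hpt X
  calc ‖charFun μ (a + z) - charFun μ a * charFun μ z‖
      = ‖(charFun μ (a + z) - charFun μ a) - charFun μ a * (charFun μ z - 1)‖ := by ring_nf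
    _ ≤ ‖charFun μ (a + z) - charFun μ a‖ + ‖charFun μ a‖ * ‖charFun μ z - 1‖ := by
      rw [← norm_mul]
      exact norm_sub_le _ _
    _ ≤ (∫ X, ‖V.starProjection X‖ ∂μ) * ‖z‖ + 1 * ((∫ X, ‖V.starProjection X‖ ∂μ) * ‖z‖) := by
      gcongr
      exact norm_charFun_le_one _
    _ = _ := by ring

open Classical in
/-- Indicator that the components of `x` in two distinct subspaces are both nonzero. -/
noncomputable def pairIndicator (F G : Subsp n) (x : Euc n) : ℝ≥0∞ :=
  if F ≠ G ∧ F.starProjection x ≠ 0 ∧ G.starProjection x ≠ 0 then 1 else 0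

open Classical in
/-- The length of the component of `x` in `V`, if the component in `F` is nonzero. -/
noncomputable def attachedNorm (V F : Subsp n) (x : Euc n) : ℝ≥0∞ :=
  if F.starProjection x ≠ 0 then ‖V.starProjection x‖ₑ else 0

theorem measurable_pairIndicator (F G : Subsp n) : Measurable (pairIndicator F G) := by
  have hF : ∀ F : Subsp n, MeasurableSet {x : Euc n | F.starProjection x ≠ 0} := fun F =>
    (isOpen_ne_fun F.starProjection.continuous continuous_const).measurableSet
  exact Measurable.ite ((MeasurableSet.const _).inter ((hF F).inter (hF G))) measurable_const
    measurable_const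

theorem measurable_attachedNorm (V F : Subsp n) : Measurable (attachedNorm V F) :=
  Measurable.ite (isOpen_ne_fun F.starProjection.continuous continuous_const).measurableSet
    (by fun_prop) measurable_const

/-- If E separates F and G, neither piece of x has components in both; otherwise at most one piece
does. The rate is the probability that F and G are on the same side, which is less than 1. -/
theorem exists_pairIndicator_contraction (ξ : Measure (Subsp n)) [IsProbabilityMeasure ξ]
    {F G : Subsp n} (hF : F ∈ independentSubspaces ξ) (hG : G ∈ independentSubspaces ξ) :
    ∃ ρ : ℝ≥0∞, ρ < 1 ∧ ∀ x, ∫⁻ E : Subsp n, (pairIndicator F G (E.starProjection x) +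
      pairIndicator F G ((Eᗮ : Subsp n).starProjection x)) ∂ξ ≤ ρ * pairIndicator F G x := by
  classical
  by_cases hne : F = G
  · exact ⟨0, zero_lt_one, fun x => by simp [pairIndicator, hne]⟩
  set S : Set (Subsp n) := {E | F ≤ E ↔ G ≤ E} with hS
  have hSm : MeasurableSet S := (measurableSet_le F).iff (measurableSet_le G)
  refine ⟨ξ S, lt_of_le_of_ne prob_le_one fun h => not_ae_same_side hF hG hne
    ((mem_ae_iff_prob_eq_one hSm).2 h), fun x => ?_⟩
  have hpt : ∀ᵐ E : Subsp n ∂ξ, pairIndicator F G (E.starProjection x) +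
      pairIndicator F G ((Eᗮ : Subsp n).starProjection x) ≤
        S.indicator (fun _ => pairIndicator F G x) E := by
    filter_upwards [ae_compatible ξ] with E hE
    have hside : ∀ H ∈ independentSubspaces ξ,
        (H ≤ E ∧ H.starProjection (E.starProjection x) = H.starProjection x) ∨
        (¬ H ≤ E ∧ H.starProjection (E.starProjection x) = 0) := by
      intro H hH
      by_cases hHE : H ≤ E
      · exact Or.inl ⟨hHE, starProjection_starProjection_of_le hHE x⟩
      · exact Or.inr ⟨hHE, starProjection_starProjection_of_le_orthogonal
          ((hE H hH).resolve_left hHE) x⟩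
    rcases hside F hF with ⟨f1, f2⟩ | ⟨f1, f2⟩ <;>
      rcases hside G hG with ⟨g1, g2⟩ | ⟨g1, g2⟩ <;>
      simp [pairIndicator, hS, Set.indicator, f1, f2, g1, g2]
  refine (lintegral_mono_ae hpt).trans_eq ?_
  rw [lintegral_indicator_const hSm, mul_comm]

/-- Only the piece of x on the side of F keeps an F-component, and its dependent component is
`sideProj F E` of that of x, which shrinks on average. -/
theorem exists_attachedNorm_contraction (ξ : Measure (Subsp n)) [IsProbabilityMeasure ξ]
    {F : Subsp n} (hF : F ∈ independentSubspaces ξ) :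
    ∃ ρ : ℝ≥0∞, ρ < 1 ∧ ∀ x, ∫⁻ E : Subsp n,
      (attachedNorm (depSubspace ξ) F (E.starProjection x) +
        attachedNorm (depSubspace ξ) F ((Eᗮ : Subsp n).starProjection x)) ∂ξ ≤
      ρ * attachedNorm (depSubspace ξ) F x := by
  obtain ⟨ρ, hρ, hc⟩ := exists_sideProj_contraction ξ F
  refine ⟨ρ, hρ, fun x => ?_⟩
  have hpt : ∀ᵐ E : Subsp n ∂ξ, attachedNorm (depSubspace ξ) F (E.starProjection x) +
        attachedNorm (depSubspace ξ) F ((Eᗮ : Subsp n).starProjection x) ≤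
      if F.starProjection x = 0 then 0 else
        ‖sideProj F E ((depSubspace ξ).starProjection x)‖ₑ := by
    filter_upwards [ae_compatible ξ] with E hE
    by_cases hFE : F ≤ E
    · have h1 := starProjection_starProjection_of_le hFE x
      simp [attachedNorm, sideProj, hFE, h1, hE.dep_starProjection_comm]
    · have hFE' := (hE F hF).resolve_left hFE
      have h1 := starProjection_starProjection_of_le_orthogonal hFE' x
      simp [attachedNorm, sideProj, hFE, h1, hE.dep_starProjection_comm]
  refine (lintegral_mono_ae hpt).trans ?_
  by_cases hx : F.starProjection x = 0
  · simp [hx]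
  · simpa [hx, attachedNorm] using hc _ (Submodule.starProjection_apply_mem _ x)

/-- Finitely many contracted functions are contracted jointly. -/
theorem exists_sum_contraction (ξ : Measure (Subsp n)) {ι : Type*} [Fintype ι]
    {L : ι → Euc n → ℝ≥0∞} (hm : ∀ i, Measurable (L i))
    (h : ∀ i, ∃ ρ : ℝ≥0∞, ρ < 1 ∧ ∀ x, ∫⁻ E : Subsp n, (L i (E.starProjection x) +
      L i ((Eᗮ : Subsp n).starProjection x)) ∂ξ ≤ ρ * L i x) :
    ∃ ρ : ℝ≥0∞, ρ < 1 ∧ ∀ x, ∫⁻ E : Subsp n, (∑ i, L i (E.starProjection x) +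
      ∑ i, L i ((Eᗮ : Subsp n).starProjection x)) ∂ξ ≤ ρ * ∑ i, L i x := by
  choose ρ hρ hc using h
  -- The largest rate serves for all; for an empty index type the supremum is 0.
  refine ⟨Finset.univ.sup ρ, (Finset.sup_lt_iff (by simp)).2 fun i _ => hρ i, fun x => ?_⟩
  simp_rw [← Finset.sum_add_distrib]
  have hmi : ∀ i, Measurable fun E : Subsp n =>
      L i (E.starProjection x) + L i ((Eᗮ : Subsp n).starProjection x) := fun i =>
    ((hm i).comp (measurable_starProjection_apply x)).add
      ((hm i).comp (measurable_starProjection_orthogonal_apply x))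
  rw [lintegral_finsetSum _ fun i _ => hmi i, Finset.mul_sum]
  refine Finset.sum_le_sum fun i _ => (hc i x).trans ?_
  gcongr
  exact Finset.le_sup (f := ρ) (Finset.mem_univ i)

/-- The discrepancy of φ and the product vanishes if all independent components of x are zero. If
exactly one is nonzero, it is at most a multiple of the norm of the dependent component, by
`norm_charFun_add_sub_mul_le`. If two are nonzero, it is at most 2. A sum of contracted functions
thus controls it, and iteration with N = 0 makes it vanish. -/
theorem IsMixture.charFun_eq_prodChar {μ : Measure (Euc n)} [IsProbabilityMeasure μ]
    {ξ : Measure (Subsp n)} [IsProbabilityMeasure ξ] (h : IsMixture μ ξ)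
    (hV : Integrable (fun X => (depSubspace ξ).starProjection X) μ)
    (hdep : ∀ᵐ E : Subsp n ∂ξ, ∀ z ∈ depSubspace ξ, charFun μ z =
      charFun μ (E.starProjection z) * charFun μ ((Eᗮ : Subsp n).starProjection z)) (x : Euc n) :
    charFun μ x = prodChar ξ μ x := by
  set S := independentSubspaces ξ with hS
  let L : (S × S) ⊕ S → Euc n → ℝ≥0∞ :=
    Sum.elim (fun p => pairIndicator p.1.1 p.2.1) fun α => attachedNorm (depSubspace ξ) α.1
  obtain ⟨ρ, hρ, hc⟩ := exists_sum_contraction ξ (L := L)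
    (by rintro (p | α)
        · exact measurable_pairIndicator _ _
        · exact measurable_attachedNorm _ _)
    (by rintro (p | α)
        · exact exists_pairIndicator_contraction ξ p.1.2 p.2.2
        · exact exists_attachedNorm_contraction ξ α.2)
  set M : ℝ := ∫ X, ‖(depSubspace ξ).starProjection X‖ ∂μ with hM
  have hM0 : 0 ≤ M := integral_nonneg fun X => norm_nonneg _
  have key := le_of_subharmonic ξ (D := Set.univ)
    (u := fun x => ‖charFun μ x - prodChar ξ μ x‖ₑ) (N := fun _ => 0) (L := fun x => ∑ i, L i x)
    (C := ENNReal.ofReal (2 + 2 * M)) (ρ := ρ) (by simp) measurable_const ENNReal.ofReal_ne_top hρ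
    ?_ (by simp) (fun x _ => hc x) ?_ ?_ x (Set.mem_univ x)
  · simpa [sub_eq_zero] using key
  · intro x _
    refine ENNReal.sum_ne_top.2 ?_
    rintro (p | α) _
    · simp only [L, Sum.elim_inl, pairIndicator]
      split_ifs <;> simp
    · simp only [L, Sum.elim_inr, attachedNorm]
      split_ifs <;> simp
  · intro x _
    refine h.enorm_charFun_sub_le (norm_prodChar_le_one ξ μ) ?_
    filter_upwards [hdep, ae_compatible ξ] with E h1 h2 using prodChar_split h2 h1 x
  · intro x _
    rw [zero_add]
    have hle : ∀ i, L i x ≤ ∑ i, L i x := fun i =>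
      Finset.single_le_sum (f := fun i => L i x) (fun _ _ => zero_le) (Finset.mem_univ i)
    have hdec := sum_starProjection_add_dep ξ x
    by_cases hex : ∃ α : S, α.1.starProjection x ≠ 0
    · obtain ⟨α, hα⟩ := hex
      by_cases hex2 : ∃ β : S, β ≠ α ∧ β.1.starProjection x ≠ 0
      · obtain ⟨β, hβα, hβ⟩ := hex2
        have h1 : L (Sum.inl (α, β)) x = 1 := by
          have : α.1 ≠ β.1 := fun h => hβα (Subtype.ext h.symm)
          simp [L, pairIndicator, hα, hβ, this]
        have h2 : ‖charFun μ x - prodChar ξ μ x‖ ≤ 2 + 2 * M := by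
          refine (norm_sub_le _ _).trans ?_
          linarith [norm_charFun_le_one (μ := μ) x, norm_prodChar_le_one ξ μ x]
        calc ‖charFun μ x - prodChar ξ μ x‖ₑ ≤ ENNReal.ofReal (2 + 2 * M) := by
              rw [← ofReal_norm]; exact ENNReal.ofReal_le_ofReal h2
          _ = ENNReal.ofReal (2 + 2 * M) * L (Sum.inl (α, β)) x := by rw [h1, mul_one]
          _ ≤ _ := by gcongr; exact hle _
      · push Not at hex2
        have hsum : ∑ β : S, β.1.starProjection x = α.1.starProjection x :=
          Finset.sum_eq_single α (fun β _ hβ => hex2 β hβ) (by simp)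
        have hprod : prodChar ξ μ x = charFun μ (α.1.starProjection x) *
            charFun μ ((depSubspace ξ).starProjection x) := by
          rw [prodChar, Finset.prod_eq_single α (fun β _ hβ => by rw [hex2 β hβ]; simp) (by simp)]
        have h1 : L (Sum.inr α) x = ‖(depSubspace ξ).starProjection x‖ₑ := by
          simp [L, attachedNorm, hα]
        have h2 := norm_charFun_add_sub_mul_le hV (α.1.starProjection x)
          ((depSubspace ξ).starProjection_apply_mem x)
        rw [← hsum, hdec, hsum, ← hprod] at h2
        calc ‖charFun μ x - prodChar ξ μ x‖ₑ
            ≤ ENNReal.ofReal ((2 + 2 * M) * ‖(depSubspace ξ).starProjection x‖) := by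
              rw [← ofReal_norm]
              refine ENNReal.ofReal_le_ofReal (h2.trans ?_)
              gcongr
              linarith
          _ = ENNReal.ofReal (2 + 2 * M) * L (Sum.inr α) x := by
              rw [h1, ENNReal.ofReal_mul (by positivity), ofReal_norm]
          _ ≤ _ := by gcongr; exact hle _
    · push Not at hex
      have hsum : ∑ β : S, β.1.starProjection x = 0 := Finset.sum_eq_zero fun β _ => hex β
      rw [hsum, zero_add] at hdec
      have hprod : prodChar ξ μ x = charFun μ x := by
        rw [prodChar, hdec, Finset.prod_eq_one fun β _ => by rw [hex β]; simp, one_mul]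
      simp [hprod]

/-! ### The three implications -/

theorem integrable_log_marginal_iff (μ : Measure (Euc n)) (V : Subsp n) :
    Integrable (fun x : V => Real.log (1 + ‖x‖)) (marginal μ V) ↔
      Integrable (fun X => Real.log (1 + ‖V.starProjection X‖)) μ := by
  rw [marginal, integrable_map_measure (Measurable.aestronglyMeasurable (by fun_prop))
    (by fun_prop)]
  rfl

/-- Splitting yields second moments on the dependent subspace without any prior integrability, and
log(1 + t) ≤ t then gives the logarithmic moment. -/
theorem SplitsWrt.log_integrable_and_isMixture {μ : Measure (Euc n)} [IsProbabilityMeasure μ]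
    {ξ : Measure (Subsp n)} [IsProbabilityMeasure ξ] (h : SplitsWrt μ ξ) :
    Integrable (fun x : depSubspace ξ => Real.log (1 + ‖x‖)) (marginal μ (depSubspace ξ)) ∧
      IsMixture μ ξ := by
  refine ⟨(integrable_log_marginal_iff _ _).2 ?_, h.isMixture⟩
  have hdep := h.isMixture.dep_le_secondMoment fun F hF hinv hF0 =>
    h.quadraticAlongSequence hF hinv hF0
  refine ((memLp_starProjection_of_le hdep).integrable (by norm_num)).norm.mono'
    (Measurable.aestronglyMeasurable (by fun_prop)) (.of_forall fun X => ?_)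
  have h0 := norm_nonneg ((depSubspace ξ).starProjection X)
  rw [Real.norm_of_nonneg (Real.log_nonneg (by linarith))]
  linarith [Real.log_le_sub_one_of_pos
    (show 0 < 1 + ‖(depSubspace ξ).starProjection X‖ by linarith)]

theorem IsMixture.eq_independentProd_and_gaussian {μ : Measure (Euc n)} [IsProbabilityMeasure μ]
    {ξ : Measure (Subsp n)} [IsProbabilityMeasure ξ] (h : IsMixture μ ξ)
    (hlog : Integrable (fun x : depSubspace ξ => Real.log (1 + ‖x‖))
      (marginal μ (depSubspace ξ))) :
    μ = independentProd ξ μ ∧ IsGaussian (marginal μ (depSubspace ξ)) ∧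
      CovSplits μ (depSubspace ξ) ξ := by
  -- The logarithmic moment is needed only here, to obtain second moments.
  have hdep := h.dep_le_secondMoment fun F hF hinv hF0 =>
    h.quadraticAlongSequence ((integrable_log_marginal_iff _ _).1 hlog) hF hinv hF0
  obtain ⟨hg, hc⟩ := h.isGaussian_and_covSplits hdep
  refine ⟨(eq_independentProd_iff ξ μ).2 fun x => ?_, hg, hc⟩
  exact h.charFun_eq_prodChar ((memLp_starProjection_of_le hdep).integrable (by norm_num))
    (ae_charFun_split_of_isGaussian hg hc) x

theorem splitsWrt_of_eq_independentProd {μ : Measure (Euc n)} [IsProbabilityMeasure μ]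
    {ξ : Measure (Subsp n)} [IsProbabilityMeasure ξ] (h : μ = independentProd ξ μ)
    (hg : IsGaussian (marginal μ (depSubspace ξ))) (hc : CovSplits μ (depSubspace ξ) ξ) :
    SplitsWrt μ ξ := by
  rw [eq_independentProd_iff] at h
  unfold SplitsWrt
  filter_upwards [ae_charFun_split_of_isGaussian hg hc, ae_compatible ξ] with E h1 h2
  rw [splitsAlong_iff_charFun]
  intro x
  rw [h, h (E.starProjection x), h ((Eᗮ : Subsp n).starProjection x)]
  exact prodChar_split h2 h1 x

end SplittingMeasures

theorem theorem1 (n : ℕ)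
    (ξ : MeasureTheory.Measure (SplittingMeasures.Subsp n)) [MeasureTheory.IsProbabilityMeasure ξ]
    (μ : MeasureTheory.Measure (SplittingMeasures.Euc n)) [MeasureTheory.IsProbabilityMeasure μ] :
    List.TFAE [
      SplittingMeasures.SplitsWrt μ ξ,
      μ = SplittingMeasures.independentProd ξ μ ∧
        ProbabilityTheory.IsGaussian
          (SplittingMeasures.marginal μ (SplittingMeasures.depSubspace ξ)) ∧
        SplittingMeasures.CovSplits μ (SplittingMeasures.depSubspace ξ) ξ,
      MeasureTheory.Integrable (fun x : SplittingMeasures.depSubspace ξ => Real.log (1 + ‖x‖))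
          (SplittingMeasures.marginal μ (SplittingMeasures.depSubspace ξ)) ∧
        SplittingMeasures.IsMixture μ ξ] := by
  tfae_have 1 → 3 := fun h => h.log_integrable_and_isMixture
  tfae_have 3 → 2 := fun h => h.2.eq_independentProd_and_gaussian h.1
  tfae_have 2 → 1 := fun h => SplittingMeasures.splitsWrt_of_eq_independentProd h.1 h.2.1 h.2.2
  tfae_finish
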